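/- Let $G_0$ be the complete graph on $\{(0,0),(1,0),(0,1)\}\subset\mathbb{Z}^2$, and let $G_{k+1}$ be the union of the translates of $G_k$ by $(0,0)$, $(2^k,0)$ and $(0,2^k)$. Put $\mathsf{SG}^+=\bigcup_{k\ge 0}G_k$ and $\mathsf{SG}=\mathsf{SG}^+\cup(-\mathsf{SG}^+)$, the doubly infinite Sierpinski gasket graph (a $4$-regular graph), with origin $o=(0,0)$ and neighbour relation $\sim$. For an integer $r$ let $B_r$ be the set of vertices at graph distance at most $r$ from $o$ (so $B_r=\emptyset$ for $r<0$), let $\partial A=\{u\in A:\exists v\notin A,\ u\sim v\}$, and let $b_k=|B_k|-\tfrac12|\partial B_k|$ for integers $k\ge 0$; in particular $b_0=\tfrac12$. Divisible sandpile with height function $1$: put $\Delta f(x)=\tfrac14\sum_{y\sim x}f(y)-f(x)$ and $T_x\mu=\mu+\max\{\mu(x)-1,0\}\,\Delta\delta_x$. For $m\ge 0$ and a sequence $x_1,x_2,\dots$ of vertices containing each vertex of $\mathsf{SG}$ infinitely often, let $\mu_0=m\delta_o$, $\mu_k=T_{x_k}\mu_{k-1}$, and $u_k(y)=\sum_{1\le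 j\le k,\ x_j=y}\big(\mu_{j-1}(y)-\mu_j(y)\big)$, the mass emitted from $y$ in the first $k$ topplings. **Theorem.** Let $m\ge 0$. There is a function $u:\mathsf{SG}\to\mathbb{R}$, the odometer function, such that $u_k\to u$ pointwise for every such sequence $(x_k)$. Let $S_m=\{z\in\mathsf{SG}:u(z)>0\}$ be the sandpile cluster. If $m\ge\tfrac12$, then $n=\max\{k\ge 0:b_k\le m\}$ exists and $$B_{n-1}\subseteq S_m\subseteq B_n .$$ If $m<\tfrac12$ (so that no $k\ge0$ satisfies $b_k\le m$), then $S_m=\emptyset$. -/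

import Mathlib

open Filter Topology

namespace Gasket

/-! ### The doubly infinite graphical Sierpinski gasket -/

/-- The three vertices `(0,0)`, `(1,0)`, `(0,1)` of the initial triangle. -/
def baseTriangle : Set (ℤ × ℤ) := {(0, 0), (1, 0), (0, 1)}

/-- The translation vectors `(0,0)`, `(2^k,0)`, `(0,2^k)`. -/
def shift (k : ℕ) : Fin 3 → ℤ × ℤ := ![(0, 0), (2 ^ k, 0), (0, 2 ^ k)]

/-- The vertex set of the `k`-th finite gasket graph `G_k`. -/
def iterVerts : ℕ → Set (ℤ × ℤ)
  | 0 => baseTriangle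
  | k + 1 => ⋃ i : Fin 3, (fun v => v + shift k i) '' iterVerts k

/-- The edges of `G_k`, as a graph on `ℤ × ℤ`: `G_0` is the complete graph on the base triangle,
and `G_{k+1}` is the union of the three translates of `G_k`. -/
def iterGraph : ℕ → SimpleGraph (ℤ × ℤ)
  | 0 => SimpleGraph.fromRel fun u v => u ∈ baseTriangle ∧ v ∈ baseTriangle
  | k + 1 => ⨆ i : Fin 3, (iterGraph k).map (Equiv.addRight (shift k i)).toEmbedding

/-- The vertices of the one-sided gasket `SG⁺ = ⋃ G_k`. -/
def plusVerts : Set (ℤ × ℤ) := ⋃ k, iterVerts k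

/-- The edges of the one-sided gasket `SG⁺ = ⋃ G_k`. -/
def plusGraph : SimpleGraph (ℤ × ℤ) := ⨆ k, iterGraph k

/-- The vertices of `SG = SG⁺ ∪ (-SG⁺)`. -/
def verts : Set (ℤ × ℤ) := plusVerts ∪ (fun v => -v) '' plusVerts

/-- The edges of `SG = SG⁺ ∪ (-SG⁺)`, as a graph on `ℤ × ℤ`. -/
def fullGraph : SimpleGraph (ℤ × ℤ) :=
  plusGraph ⊔ plusGraph.map (Equiv.neg (ℤ × ℤ)).toEmbedding

/-- The double-sided graphical Sierpinski gasket, as a graph on its own vertex set. -/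
def SG : SimpleGraph verts := fullGraph.induce verts

theorem zero_mem_verts : ((0, 0) : ℤ × ℤ) ∈ verts :=
  Or.inl (Set.mem_iUnion.2 ⟨0, Or.inl rfl⟩)

/-- The origin `o = (0,0)`. -/
def origin : verts := ⟨(0, 0), zero_mem_verts⟩

/-! ### Local finiteness, so that sums over neighbours are finite sums -/

theorem iterGraph_adj_bound (k : ℕ) (u v : ℤ × ℤ) (h : (iterGraph k).Adj u v) :
    |v.1 - u.1| ≤ 1 ∧ |v.2 - u.2| ≤ 1 := by
  induction k generalizing u v with
  | zero =>
    simp only [iterGraph, SimpleGraph.fromRel_adj, baseTriangle, Set.mem_insert_iff,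
      Set.mem_singleton_iff] at h
    obtain ⟨-, ⟨hu, hv⟩ | ⟨hv, hu⟩⟩ := h <;>
      rcases hu with rfl | rfl | rfl <;> rcases hv with rfl | rfl | rfl <;> simp
  | succ k ih =>
    simp only [iterGraph, SimpleGraph.iSup_adj, SimpleGraph.map_adj] at h
    obtain ⟨i, u', v', h', rfl, rfl⟩ := h
    simpa using ih u' v' h'

theorem SG_adj_bound (u v : verts) (h : SG.Adj u v) :
    |v.1.1 - u.1.1| ≤ 1 ∧ |v.1.2 - u.1.2| ≤ 1 := by
  have h' : fullGraph.Adj u.1 v.1 := h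
  rw [fullGraph, SimpleGraph.sup_adj, SimpleGraph.map_adj] at h'
  rcases h' with h' | ⟨a, b, h', ha, hb⟩
  · obtain ⟨k, hk⟩ := SimpleGraph.iSup_adj.1 h'
    exact iterGraph_adj_bound k _ _ hk
  · obtain ⟨k, hk⟩ := SimpleGraph.iSup_adj.1 h'
    have := iterGraph_adj_bound k _ _ hk
    rw [← ha, ← hb]
    simp only [Equiv.coe_toEmbedding, Equiv.neg_apply, Prod.fst_neg, Prod.snd_neg, abs_le] at this ⊢
    omega

theorem finite_neighborSet (u : verts) : (SG.neighborSet u).Finite := by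
  have hf : (Set.Icc (u.1.1 - 1) (u.1.1 + 1) ×ˢ Set.Icc (u.1.2 - 1) (u.1.2 + 1)).Finite :=
    (Set.finite_Icc _ _).prod (Set.finite_Icc _ _)
  refine (hf.preimage (f := (Subtype.val : verts → ℤ × ℤ))
    Subtype.val_injective.injOn).subset ?_
  intro v hv
  have := SG_adj_bound u v hv
  simp only [abs_le] at this
  simp only [Set.mem_preimage, Set.mem_prod, Set.mem_Icc]
  omega

noncomputable instance : SG.LocallyFinite := fun u => (finite_neighborSet u).fintype

/-! ### Balls -/

/-- The ball `B_r` of radius `r` about the origin in the graph metric (empty for `r < 0`). -/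
def ball (r : ℤ) : Set verts := {v | SG.Reachable origin v ∧ (SG.dist origin v : ℤ) ≤ r}

/-- The inner boundary `∂A = {u ∈ A : u ∼ v for some v ∉ A}`. -/
def innerBoundary (A : Set verts) : Set verts := {u | u ∈ A ∧ ∃ v, v ∉ A ∧ SG.Adj u v}

/-- `b_k = |B_k| - ½ |∂B_k|`. -/
noncomputable def ballMass (k : ℕ) : ℝ :=
  ((ball k).ncard : ℝ) - 1 / 2 * ((innerBoundary (ball k)).ncard : ℝ)

/-! ### The divisible sandpile -/

/-- The graph Laplacian `Δf(x) = ¼ ∑_{y ∼ x} f(y) - f(x)` of the (4-regular) graph `SG`. -/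
noncomputable def laplacian (f : verts → ℝ) (x : verts) : ℝ :=
  1 / 4 * ∑ y ∈ SG.neighborFinset x, f y - f x

/-- The toppling operator `T_x μ = μ + max {μ(x) - h(x), 0} Δδ_x` with height function `h`. -/
noncomputable def topple (h : verts → ℝ) (x : verts) (μ : verts → ℝ) : verts → ℝ :=
  fun y => μ y + max (μ x - h x) 0 * laplacian (Pi.single x 1) y

/-- A toppling sequence contains every vertex infinitely often. -/
def IsTopplingSeq (x : ℕ → verts) : Prop := ∀ v : verts, {k : ℕ | x k = v}.Infinite

/-- The sand distribution after `k` topplings; step `k + 1` topples the vertex `x k`. -/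
noncomputable def sand (h μ₀ : verts → ℝ) (x : ℕ → verts) : ℕ → verts → ℝ
  | 0 => μ₀
  | k + 1 => topple h (x k) (sand h μ₀ x k)

/-- The odometer function after `k` topplings: the total mass emitted from `y` during the first
`k` topplings. -/
noncomputable def partialOdometer (h μ₀ : verts → ℝ) (x : ℕ → verts) (k : ℕ) (y : verts) : ℝ :=
  ∑ j ∈ Finset.range k with x j = y, (sand h μ₀ x j y - sand h μ₀ x (j + 1) y)

/-- `u` is the odometer function of the divisible sandpile with initial distribution `μ₀` and height
function `h`: for every toppling sequence the odometer functions converge pointwise to `u`. -/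
def IsOdometer (h μ₀ u : verts → ℝ) : Prop :=
  ∀ x : ℕ → verts, IsTopplingSeq x →
    ∀ y, Tendsto (fun k => partialOdometer h μ₀ x k y) atTop (𝓝 (u y))

/-- The sandpile cluster of the odometer function `u`. -/
def cluster (u : verts → ℝ) : Set verts := {z | 0 < u z}

/-- Toppling sequences exist. -/
theorem exists_isTopplingSeq : ∃ x : ℕ → verts, IsTopplingSeq x := by
  have : Nonempty verts := ⟨origin⟩
  obtain ⟨f, hf⟩ := exists_surjective_nat verts
  refine ⟨fun k => f k.unpair.1, fun v => ?_⟩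
  obtain ⟨a, rfl⟩ := hf v
  refine Set.infinite_of_injective_forall_mem (f := fun n : ℕ => Nat.pair a n) ?_ ?_
  · intro n n' hn
    simpa using hn
  · intro n
    simp

/-- Hence the odometer function is uniquely determined. -/
theorem IsOdometer.unique {h μ₀ u u' : verts → ℝ} (hu : IsOdometer h μ₀ u)
    (hu' : IsOdometer h μ₀ u') : u = u' := by
  obtain ⟨x, hx⟩ := exists_isTopplingSeq
  exact funext fun y => tendsto_nhds_unique (hu x hx y) (hu' x hx y)

end Gasket

namespace Gasket

/-! The proof compares the odometer with explicit functions attached to balls. For each `n` there is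
a function `U`, positive exactly at distance less than `n` from the origin, whose Laplacian is `1`
on the ball, minus `1/2` on its inner boundary, minus `ballMass n` at the origin (`exists_ballFun`).
It is the odometer for filling the ball of radius `n` evenly, with half a unit on the boundary.

By the least action principle (`exists_isOdometer`) the odometer `u` is the least nonnegative
function `w` with `Δw + mδ_o ≤ 1`. If `m ≤ ballMass k`, then the ball function of radius `k` is such
a `w`, so `u` vanishes from distance `k` on. If `ballMass n ≤ m`, the minimum principle gives `U ≤
u`, so `u > 0` at distance less than `n` (`le_of_isStabilizing`). Taking `n` maximal and `k = n + 1`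
gives both inclusions; monotonicity of `ballMass` is never needed.

The ball functions come from self-similarity. The edges of the gasket split into triangles `{p, p +
e₁, p + e₂}`, so the Laplacian is a sum over triangles and is additive under gluing copies of `G_k`.
A level function on `G_{k+1}` of height above `2 ^ k` is built from the same level function on both
upper copies and, on the lower copy, a full level function plus a constant and a harmonic function
carrying the required flux to the two upper corners (`IsLevelFun.double`). Reflection yields the
function on the double-sided gasket, and conservation of mass identifies the mass at the origin.
Throughout, distance to the origin is `|x + y|`, because each triangle joins two consecutive levels.
-/

/-! ### Cells of the gasket and the flux operator -/

/-- The indicator function of the set of bottom left corners of the triangles of `G_k`. -/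
noncomputable def cellWeight : ℕ → ℤ → ℤ → ℝ
  | 0 => fun x y => if x = 0 ∧ y = 0 then 1 else 0
  | k + 1 => fun x y =>
      cellWeight k x y + cellWeight k (x - 2 ^ k) y + cellWeight k x (y - 2 ^ k)

theorem cellWeight_succ (k : ℕ) (x y : ℤ) : cellWeight (k + 1) x y =
    cellWeight k x y + cellWeight k (x - 2 ^ k) y + cellWeight k x (y - 2 ^ k) := rfl

/-- The weighted number of triangles `{p, p + e₁, p + e₂}` containing a point. -/
def cellCount (w : ℤ → ℤ → ℝ) (x y : ℤ) : ℝ := w x y + w (x - 1) y + w x (y - 1)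

/-- The weighted sum of `f p + f (p + e₁) + f (p + e₂) - 3 f v` over the triangles containing
the point `v = (x, y)`. -/
def cellLap (w f : ℤ → ℤ → ℝ) (x y : ℤ) : ℝ :=
  w x y * (f (x + 1) y + f x (y + 1) - 2 * f x y) +
  w (x - 1) y * (f (x - 1) y + f (x - 1) (y + 1) - 2 * f x y) +
  w x (y - 1) * (f x (y - 1) + f (x + 1) (y - 1) - 2 * f x y)

/-- The indicator function of the point `(a, b)`. -/
def dirac (a b x y : ℤ) : ℝ := if x = a ∧ y = b then 1 else 0

theorem cellWeight_support {k : ℕ} {x y : ℤ} (h : cellWeight k x y ≠ 0) :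
    0 ≤ x ∧ 0 ≤ y ∧ x + y < 2 ^ k := by
  induction k generalizing x y with
  | zero =>
    simp only [cellWeight, ne_eq, ite_eq_right_iff, one_ne_zero, imp_false, not_not] at h
    simp [h.1, h.2]
  | succ k ih =>
    have hN : (0 : ℤ) < 2 ^ k := by positivity
    rw [pow_succ]
    by_cases h1 : cellWeight k x y = 0
    · by_cases h2 : cellWeight k (x - 2 ^ k) y = 0
      · have h3 : cellWeight k x (y - 2 ^ k) ≠ 0 := fun h3 => h (by simp [cellWeight, h1, h2, h3])
        have := ih h3
        omega
      · have := ih h2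
        omega
    · have := ih h1
      omega

theorem cellWeight_eq_zero {k : ℕ} {x y : ℤ} (h : ¬(0 ≤ x ∧ 0 ≤ y ∧ x + y < 2 ^ k)) :
    cellWeight k x y = 0 := by
  by_contra h'
  exact h (cellWeight_support h')

theorem cellWeight_zero_or_one (k : ℕ) (x y : ℤ) : cellWeight k x y = 0 ∨ cellWeight k x y = 1 := by
  induction k generalizing x y with
  | zero =>
    simp only [cellWeight]
    split_ifs <;> simp
  | succ k ih =>
    simp only [cellWeight]
    by_cases h1 : cellWeight k x y = 0
    · by_cases h2 : cellWeight k (x - 2 ^ k) y = 0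
      · simpa [h1, h2] using ih x (y - 2 ^ k)
      · have := cellWeight_support h2
        rw [cellWeight_eq_zero (x := x) (y := y - 2 ^ k) (by omega), h1]
        simpa using ih (x - 2 ^ k) y
    · have := cellWeight_support h1
      rw [cellWeight_eq_zero (x := x) (y := y - 2 ^ k) (by omega),
        cellWeight_eq_zero (x := x - 2 ^ k) (y := y) (by omega)]
      simpa using ih x y

theorem mem_iterVerts_zero {x y : ℤ} :
    (x, y) ∈ iterVerts 0 ↔ (x = 0 ∧ y = 0) ∨ (x = 1 ∧ y = 0) ∨ (x = 0 ∧ y = 1) := by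
  simp [iterVerts, baseTriangle]

theorem mem_iterVerts_succ {k : ℕ} {x y : ℤ} : (x, y) ∈ iterVerts (k + 1) ↔
    (x, y) ∈ iterVerts k ∨ (x - 2 ^ k, y) ∈ iterVerts k ∨ (x, y - 2 ^ k) ∈ iterVerts k := by
  simp [iterVerts, Set.mem_iUnion, Fin.exists_fin_succ, shift, sub_eq_add_neg]

theorem iterVerts_region {k : ℕ} {x y : ℤ} (h : (x, y) ∈ iterVerts k) :
    0 ≤ x ∧ 0 ≤ y ∧ x + y ≤ 2 ^ k := by
  induction k generalizing x y with
  | zero =>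
    rw [mem_iterVerts_zero] at h
    rw [pow_zero]
    omega
  | succ k ih =>
    have hN : (0 : ℤ) < 2 ^ k := by positivity
    rw [pow_succ]
    rcases mem_iterVerts_succ.1 h with h | h | h <;> have := ih h <;> omega

theorem corners_mem_iterVerts (k : ℕ) :
    (0, 0) ∈ iterVerts k ∧ (2 ^ k, 0) ∈ iterVerts k ∧ (0, 2 ^ k) ∈ iterVerts k := by
  induction k with
  | zero => simp [mem_iterVerts_zero]
  | succ k ih =>
    simp only [mem_iterVerts_succ, pow_succ, mul_two, add_sub_cancel_right]
    simp [ih]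

theorem mem_iterVerts_iff_cellCount_ne_zero {k : ℕ} {x y : ℤ} :
    (x, y) ∈ iterVerts k ↔ cellCount (cellWeight k) x y ≠ 0 := by
  induction k generalizing x y with
  | zero =>
    rw [mem_iterVerts_zero]
    simp only [cellCount, cellWeight]
    split_ifs <;> norm_num <;> omega
  | succ k ih =>
    rw [mem_iterVerts_succ, ih, ih, ih]
    have h0 : ∀ a b, 0 ≤ cellWeight k a b := fun a b => by
      rcases cellWeight_zero_or_one k a b with h | h <;> simp [h]
    have h1 : ∀ a b, 0 ≤ cellCount (cellWeight k) a b := fun a b =>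
      add_nonneg (add_nonneg (h0 _ _) (h0 _ _)) (h0 _ _)
    have h2 : cellCount (cellWeight (k + 1)) x y = cellCount (cellWeight k) x y +
        cellCount (cellWeight k) (x - 2 ^ k) y + cellCount (cellWeight k) x (y - 2 ^ k) := by
      simp only [cellCount, cellWeight, sub_right_comm _ (1 : ℤ)]
      ring
    rw [h2]
    have a1 := h1 x y
    have a2 := h1 (x - 2 ^ k) y
    have a3 := h1 x (y - 2 ^ k)
    constructor
    · rintro (h | h | h) <;> [have := a1.lt_of_ne' h; have := a2.lt_of_ne' h;
        have := a3.lt_of_ne' h] <;> linarith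
    · intro h
      by_contra! h'
      exact h (by simp [h'])

/-- Each vertex that is not a corner of `G_k` lies in an even number of triangles. -/
theorem cellCount_parity (k : ℕ) (x y : ℤ) : ∃ j : ℤ, cellCount (cellWeight k) x y =
    2 * j + dirac 0 0 x y + dirac (2 ^ k) 0 x y + dirac 0 (2 ^ k) x y := by
  induction k generalizing x y with
  | zero =>
    refine ⟨0, ?_⟩
    simp only [cellCount, cellWeight, dirac, pow_zero, sub_eq_zero]
    simp
  | succ k ih =>
    obtain ⟨j₀, h₀⟩ := ih x y
    obtain ⟨j₁, h₁⟩ := ih (x - 2 ^ k) y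
    obtain ⟨j₂, h₂⟩ := ih x (y - 2 ^ k)
    -- The extra terms are the three gluing points, each of which is a corner of exactly two of the
    -- three copies.
    refine ⟨j₀ + j₁ + j₂ + (if x = 2 ^ k ∧ y = 0 then 1 else 0) +
      (if x = 0 ∧ y = 2 ^ k then 1 else 0) + (if x = 2 ^ k ∧ y = 2 ^ k then 1 else 0), ?_⟩
    have h : cellCount (cellWeight (k + 1)) x y = cellCount (cellWeight k) x y +
        cellCount (cellWeight k) (x - 2 ^ k) y + cellCount (cellWeight k) x (y - 2 ^ k) := by
      simp only [cellCount, cellWeight, sub_right_comm _ (1 : ℤ)]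
      ring
    rw [h, h₀, h₁, h₂]
    simp only [dirac, sub_eq_iff_eq_add, zero_add, pow_succ, mul_two]
    push_cast
    ring

theorem cellLap_congr {w f g : ℤ → ℤ → ℝ}
    (h : ∀ x y, w x y ≠ 0 → f x y = g x y ∧ f (x + 1) y = g (x + 1) y ∧ f x (y + 1) = g x (y + 1))
    (x y : ℤ) : cellLap w f x y = cellLap w g x y := by
  unfold cellLap
  congr 1
  · congr 1
    · by_cases hw : w x y = 0
      · simp [hw]
      · obtain ⟨h1, h2, h3⟩ := h x y hw
        rw [h1, h2, h3]
    · by_cases hw : w (x - 1) y = 0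
      · simp [hw]
      · obtain ⟨h1, h2, h3⟩ := h _ _ hw
        rw [sub_add_cancel] at h2
        rw [h1, h2, h3]
  · by_cases hw : w x (y - 1) = 0
    · simp [hw]
    · obtain ⟨h1, h2, h3⟩ := h _ _ hw
      rw [sub_add_cancel] at h3
      rw [h1, h2, h3]

theorem cellLap_congr_of_region {k : ℕ} {f g : ℤ → ℤ → ℝ}
    (h : ∀ x y, 0 ≤ x → 0 ≤ y → x + y ≤ 2 ^ k → f x y = g x y) (x y : ℤ) :
    cellLap (cellWeight k) f x y = cellLap (cellWeight k) g x y := by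
  refine cellLap_congr (fun a b hab => ?_) x y
  have := cellWeight_support hab
  exact ⟨h _ _ (by omega) (by omega) (by omega), h _ _ (by omega) (by omega) (by omega),
    h _ _ (by omega) (by omega) (by omega)⟩

/-! ### Gluing functions on the three pieces -/

/-- The function on `G_{k+1}` that restricts to `g₀`, `g₁`, `g₂` on the three copies of `G_k`,
where `N = 2 ^ k`. -/
def glue (N : ℤ) (g₀ g₁ g₂ : ℤ → ℤ → ℝ) (x y : ℤ) : ℝ :=
  if N ≤ x then g₁ (x - N) y else if N ≤ y then g₂ x (y - N) else g₀ x y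

theorem glue_left {N : ℤ} {g₀ g₁ g₂ : ℤ → ℤ → ℝ} (h1 : g₀ N 0 = g₁ 0 0) (h2 : g₀ 0 N = g₂ 0 0)
    {x y : ℤ} (hx : 0 ≤ x) (hy : 0 ≤ y) (hxy : x + y ≤ N) :
    glue N g₀ g₁ g₂ x y = g₀ x y := by
  unfold glue
  split_ifs with hx' hy'
  · obtain rfl : x = N := by omega
    obtain rfl : y = 0 := by omega
    simp [h1]
  · obtain rfl : y = N := by omega
    obtain rfl : x = 0 := by omega
    simp [h2]
  · rfl

theorem glue_right {N : ℤ} {g₀ g₁ g₂ : ℤ → ℤ → ℝ} {x y : ℤ} (hx : 0 ≤ x) :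
    glue N g₀ g₁ g₂ (x + N) y = g₁ x y := by
  simp [glue, hx]

theorem glue_top {N : ℤ} {g₀ g₁ g₂ : ℤ → ℤ → ℝ} (h : g₁ 0 N = g₂ N 0)
    {x y : ℤ} (hy : 0 ≤ y) (hxy : x + y ≤ N) :
    glue N g₀ g₁ g₂ x (y + N) = g₂ x y := by
  unfold glue
  split_ifs with hx'
  · obtain rfl : x = N := by omega
    obtain rfl : y = 0 := by omega
    simp [h]
  · simp
  · omega

/-- Each triangle of `G_{k+1}` lies in a single copy of `G_k`, so no term of the sum mixes two
pieces. The hypotheses only say that the pieces agree at the three shared corners. -/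
theorem cellLap_glue {k : ℕ} {g₀ g₁ g₂ : ℤ → ℤ → ℝ} (h1 : g₀ (2 ^ k) 0 = g₁ 0 0)
    (h2 : g₀ 0 (2 ^ k) = g₂ 0 0) (h3 : g₁ 0 (2 ^ k) = g₂ (2 ^ k) 0) (x y : ℤ) :
    cellLap (cellWeight (k + 1)) (glue (2 ^ k) g₀ g₁ g₂) x y = cellLap (cellWeight k) g₀ x y +
      cellLap (cellWeight k) g₁ (x - 2 ^ k) y + cellLap (cellWeight k) g₂ x (y - 2 ^ k) := by
  set G := glue (2 ^ k) g₀ g₁ g₂ with hG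
  have e0 : cellLap (cellWeight k) g₀ x y = cellLap (cellWeight k) G x y :=
    cellLap_congr_of_region (fun a b ha hb hab => (glue_left h1 h2 ha hb hab).symm) x y
  have e1 : cellLap (cellWeight k) g₁ (x - 2 ^ k) y =
      cellLap (cellWeight k) (fun a b => G (a + 2 ^ k) b) (x - 2 ^ k) y :=
    cellLap_congr_of_region (fun a b ha _ _ => (glue_right ha).symm) _ y
  have e2 : cellLap (cellWeight k) g₂ x (y - 2 ^ k) =
      cellLap (cellWeight k) (fun a b => G a (b + 2 ^ k)) x (y - 2 ^ k) :=
    cellLap_congr_of_region (fun a b _ hb hab => (glue_top h3 hb hab).symm) x _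
  rw [e0, e1, e2]
  have s1 : ∀ z : ℤ, z - 2 ^ k + 1 + 2 ^ k = z + 1 := fun z => by ring
  have s2 : ∀ z : ℤ, z - 2 ^ k - 1 + 2 ^ k = z - 1 := fun z => by ring
  simp only [cellLap, cellWeight, sub_add_cancel, s1, s2, sub_right_comm _ (1 : ℤ)]
  have s3 : ∀ z : ℤ, z - 2 ^ k - 1 = z - 1 - 2 ^ k := fun z => by ring
  simp only [s3]
  ring

/-! ### Harmonic functions on the finite gaskets -/

/-- The harmonic function on `G_k` with values `a`, `b`, `c` at the corners `(0, 0)`, `(2 ^ k, 0)`,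
`(0, 2 ^ k)`. -/
noncomputable def harm : ℕ → ℝ → ℝ → ℝ → ℤ → ℤ → ℝ
  | 0, a, b, c => fun x y => if x = 1 then b else if y = 1 then c else a
  | k + 1, a, b, c => glue (2 ^ k)
      (harm k a ((2 * a + 2 * b + c) / 5) ((2 * a + b + 2 * c) / 5))
      (harm k ((2 * a + 2 * b + c) / 5) b ((a + 2 * b + 2 * c) / 5))
      (harm k ((2 * a + b + 2 * c) / 5) ((a + 2 * b + 2 * c) / 5) c)

theorem harm_corners (k : ℕ) (a b c : ℝ) :
    harm k a b c 0 0 = a ∧ harm k a b c (2 ^ k) 0 = b ∧ harm k a b c 0 (2 ^ k) = c := by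
  induction k generalizing a b c with
  | zero => simp [harm]
  | succ k ih =>
    have hN : (0 : ℤ) < 2 ^ k := by positivity
    have e : (2 : ℤ) ^ k * 2 - 2 ^ k = 2 ^ k := by ring
    have e' : (2 : ℤ) ^ k ≤ 2 ^ k * 2 := by omega
    simp only [harm, glue, pow_succ, hN.not_ge, if_false, e, e', if_true]
    exact ⟨(ih _ _ _).1, (ih _ _ _).2.1, (ih _ _ _).2.2⟩

theorem harm_nonneg (k : ℕ) {a b c : ℝ} (ha : 0 ≤ a) (hb : 0 ≤ b) (hc : 0 ≤ c) (x y : ℤ) :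
    0 ≤ harm k a b c x y := by
  induction k generalizing a b c x y with
  | zero =>
    simp only [harm]
    split_ifs <;> assumption
  | succ k ih =>
    simp only [harm, glue]
    split_ifs <;> apply ih <;> positivity

/-- The 2/5–2/5–1/5 rule for the midpoint values in `harm` makes the fluxes of the two copies
meeting at each gluing point cancel, while the flux at an outer corner shrinks by the factor `3/5`.
-/
theorem cellLap_harm (k : ℕ) (a b c : ℝ) (x y : ℤ) :
    cellLap (cellWeight k) (harm k a b c) x y = (3 / 5) ^ k *
      ((b + c - 2 * a) * dirac 0 0 x y + (a + c - 2 * b) * dirac (2 ^ k) 0 x y +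
        (a + b - 2 * c) * dirac 0 (2 ^ k) x y) := by
  induction k generalizing a b c x y with
  | zero =>
    simp only [cellLap, cellWeight, harm, dirac, pow_zero, sub_eq_zero]
    by_cases h0 : x = 0 ∧ y = 0
    · obtain ⟨rfl, rfl⟩ := h0
      norm_num
    by_cases h1 : x = 1 ∧ y = 0
    · obtain ⟨rfl, rfl⟩ := h1
      norm_num
    by_cases h2 : x = 0 ∧ y = 1
    · obtain ⟨rfl, rfl⟩ := h2
      norm_num
    simp [h0, h1, h2]
  | succ k ih =>
    rw [harm, cellLap_glue (by simp [harm_corners]) (by simp [harm_corners])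
      (by simp [harm_corners]), ih, ih, ih]
    simp only [dirac, sub_eq_iff_eq_add, zero_add, pow_succ, mul_two]
    ring

/-! ### Odometer functions on the finite gaskets -/

theorem cellLap_add (w f g : ℤ → ℤ → ℝ) (x y : ℤ) :
    cellLap w (fun a b => f a b + g a b) x y = cellLap w f x y + cellLap w g x y := by
  simp only [cellLap]
  ring

theorem cellLap_const_mul (w f : ℤ → ℤ → ℝ) (t : ℝ) (x y : ℤ) :
    cellLap w (fun a b => t * f a b) x y = t * cellLap w f x y := by
  simp only [cellLap]
  ring

theorem cellLap_const (w : ℤ → ℤ → ℝ) (t : ℝ) (x y : ℤ) :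
    cellLap w (fun _ _ => t) x y = 0 := by
  simp only [cellLap]
  ring

/-- The restriction of a weight to the triangles whose lower corner is below level `n`. -/
noncomputable def belowLevel (n : ℤ) (w : ℤ → ℤ → ℝ) (x y : ℤ) : ℝ := if x + y < n then w x y else 0

theorem belowLevel_eq_of_le {k : ℕ} {n : ℤ} (h : 2 ^ k ≤ n) (x y : ℤ) :
    belowLevel n (cellWeight k) x y = cellWeight k x y := by
  unfold belowLevel
  split_ifs with hlt
  · rfl
  · exact (cellWeight_eq_zero (by omega)).symm

theorem belowLevel_succ (k : ℕ) (n x y : ℤ) : belowLevel n (cellWeight (k + 1)) x y =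
    belowLevel n (cellWeight k) x y + belowLevel (n - 2 ^ k) (cellWeight k) (x - 2 ^ k) y +
      belowLevel (n - 2 ^ k) (cellWeight k) x (y - 2 ^ k) := by
  have h1 : x - 2 ^ k + y < n - 2 ^ k ↔ x + y < n := by omega
  have h2 : x + (y - 2 ^ k) < n - 2 ^ k ↔ x + y < n := by omega
  simp only [belowLevel, h1, h2, cellWeight]
  split_ifs <;> simp

theorem cellCount_belowLevel_succ (k : ℕ) (n x y : ℤ) :
    cellCount (belowLevel n (cellWeight (k + 1))) x y =
      cellCount (belowLevel n (cellWeight k)) x y +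
      cellCount (belowLevel (n - 2 ^ k) (cellWeight k)) (x - 2 ^ k) y +
      cellCount (belowLevel (n - 2 ^ k) (cellWeight k)) x (y - 2 ^ k) := by
  simp only [cellCount, belowLevel_succ, sub_right_comm _ (1 : ℤ)]
  ring

theorem belowLevel_eq_zero_of_nonpos {k : ℕ} {n : ℤ} (hn : n ≤ 0) (x y : ℤ) :
    belowLevel n (cellWeight k) x y = 0 := by
  unfold belowLevel
  split_ifs
  · exact cellWeight_eq_zero (by omega)
  · rfl

/-- The function `u` on `G_k` is positive exactly below level `n`, and its Laplacian is the one of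
the odometer function of the ball of radius `n`, with mass emitted from the origin. -/
structure IsLevelFun (k : ℕ) (n : ℤ) (u : ℤ → ℤ → ℝ) (c : ℝ) : Prop where
  pos : ∀ x y, (x, y) ∈ iterVerts k → x + y < n → 0 < u x y
  eq_zero : ∀ x y, (x, y) ∈ iterVerts k → n ≤ x + y → u x y = 0
  lap : ∀ x y, cellLap (cellWeight k) u x y =
    2 * cellCount (belowLevel n (cellWeight k)) x y - c * dirac 0 0 x y
  mass_pos : 0 < c

/-- Since `n ≤ 2 ^ k`, the function already vanishes at the two upper corners and the upper copies
contain no triangle below level `n`; extension by zero therefore creates no new Laplacian. -/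
theorem IsLevelFun.extend {k : ℕ} {n : ℤ} {u : ℤ → ℤ → ℝ} {c : ℝ} (h : IsLevelFun k n u c)
    (hn : n ≤ 2 ^ k) :
    IsLevelFun (k + 1) n (glue (2 ^ k) u (fun _ _ => 0) (fun _ _ => 0)) c := by
  obtain ⟨-, hc1, hc2⟩ := corners_mem_iterVerts k
  have z1 : u (2 ^ k) 0 = 0 := h.eq_zero _ _ hc1 (by omega)
  have z2 : u 0 (2 ^ k) = 0 := h.eq_zero _ _ hc2 (by omega)
  refine ⟨fun x y hxy hlt => ?_, fun x y hxy hle => ?_, fun x y => ?_, h.mass_pos⟩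
  · rcases mem_iterVerts_succ.1 hxy with hv | hv | hv <;> have hr := iterVerts_region hv
    · rw [glue_left z1 z2 hr.1 hr.2.1 hr.2.2]
      exact h.pos _ _ hv hlt
    · omega
    · omega
  · rcases mem_iterVerts_succ.1 hxy with hv | hv | hv <;> have hr := iterVerts_region hv
    · rw [glue_left z1 z2 hr.1 hr.2.1 hr.2.2]
      exact h.eq_zero _ _ hv hle
    · have := glue_right (N := 2 ^ k) (g₀ := u) (g₁ := fun _ _ => 0) (g₂ := fun _ _ => 0)
        (y := y) hr.1
      rwa [sub_add_cancel] at this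
    · have := glue_top (N := 2 ^ k) (g₀ := u) (g₁ := fun _ _ => 0) (g₂ := fun _ _ => 0)
        rfl hr.2.1 hr.2.2
      rwa [sub_add_cancel] at this
  · rw [cellLap_glue z1 z2 rfl, cellLap_const, cellLap_const, h.lap, cellCount_belowLevel_succ]
    have hb : belowLevel (n - 2 ^ k) (cellWeight k) = fun _ _ => 0 := by
      ext a b
      exact belowLevel_eq_zero_of_nonpos (by omega) a b
    simp [hb, cellCount]

/-- Each upper copy has mass `c` emitted from its lowest corner, which the lower copy must supply.
The constant `u 0 0` matches values at the gluing points, and the factor `(5 / 3) ^ k` cancels the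
scaling in `cellLap_harm`, so the harmonic part sends flux `c` to each upper corner and takes `2 *
c` from the origin. -/
theorem IsLevelFun.double {k : ℕ} {n : ℤ} {u v : ℤ → ℤ → ℝ} {c d : ℝ} (hn : 0 < n) (hnk : n ≤ 2 ^ k)
    (hu : IsLevelFun k n u c) (hv : IsLevelFun k (2 ^ k) v d) :
    IsLevelFun (k + 1) (2 ^ k + n)
      (glue (2 ^ k) (fun x y => u 0 0 + (v x y + c * (5 / 3) ^ k * harm k 1 0 0 x y)) u u)
      (d + 2 * c) := by
  obtain ⟨hc0, hc1, hc2⟩ := corners_mem_iterVerts k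
  have hc := hu.mass_pos
  have hu0 : 0 < u 0 0 := hu.pos _ _ hc0 (by omega)
  have hz : ∀ x y, (x, y) ∈ iterVerts k → 0 ≤ v x y := fun x y hxy => by
    rcases lt_or_ge (x + y) (2 ^ k) with h | h
    · exact (hv.pos _ _ hxy h).le
    · exact (hv.eq_zero _ _ hxy h).ge
  set g₀ : ℤ → ℤ → ℝ := fun x y => u 0 0 + (v x y + c * (5 / 3) ^ k * harm k 1 0 0 x y) with hg₀
  have z1 : g₀ (2 ^ k) 0 = u 0 0 := by
    simp [hg₀, harm_corners, hv.eq_zero _ _ hc1 (by omega)]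
  have z2 : g₀ 0 (2 ^ k) = u 0 0 := by
    simp [hg₀, harm_corners, hv.eq_zero _ _ hc2 (by omega)]
  have z3 : u 0 (2 ^ k) = u (2 ^ k) 0 := by
    rw [hu.eq_zero _ _ hc1 (by omega), hu.eq_zero _ _ hc2 (by omega)]
  have er : ∀ x y, (x - 2 ^ k, y) ∈ iterVerts k → glue (2 ^ k) g₀ u u x y = u (x - 2 ^ k) y :=
    fun x y h => by
      have := glue_right (N := 2 ^ k) (g₀ := g₀) (g₁ := u) (g₂ := u) (y := y)
        (iterVerts_region h).1
      rwa [sub_add_cancel] at this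
  have et : ∀ x y, (x, y - 2 ^ k) ∈ iterVerts k → glue (2 ^ k) g₀ u u x y = u x (y - 2 ^ k) :=
    fun x y h => by
      have := glue_top (g₀ := g₀) z3 (iterVerts_region h).2.1 (iterVerts_region h).2.2
      rwa [sub_add_cancel] at this
  refine ⟨fun x y hxy hlt => ?_, fun x y hxy hle => ?_, fun x y => ?_, ?_⟩
  · rcases mem_iterVerts_succ.1 hxy with h | h | h
    · have hr := iterVerts_region h
      rw [glue_left z1 z2 hr.1 hr.2.1 hr.2.2]
      have h1 := hz x y h
      have h2 := harm_nonneg k zero_le_one le_rfl le_rfl x y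
      positivity
    · rw [er x y h]
      exact hu.pos _ _ h (by omega)
    · rw [et x y h]
      exact hu.pos _ _ h (by omega)
  · rcases mem_iterVerts_succ.1 hxy with h | h | h
    · have hr := iterVerts_region h
      omega
    · rw [er x y h]
      exact hu.eq_zero _ _ h (by omega)
    · rw [et x y h]
      exact hu.eq_zero _ _ h (by omega)
  · rw [cellLap_glue z1 z2 z3, hu.lap, hu.lap, hg₀, cellLap_add, cellLap_const, cellLap_add,
      cellLap_const_mul, cellLap_harm, hv.lap, cellCount_belowLevel_succ, add_sub_cancel_left]
    have hb : ∀ m : ℤ, 2 ^ k ≤ m → belowLevel m (cellWeight k) = cellWeight k := fun m hm => by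
      ext a b
      exact belowLevel_eq_of_le hm a b
    rw [hb _ le_rfl, hb _ (by omega : (2 : ℤ) ^ k ≤ 2 ^ k + n)]
    have hp : (5 / 3 : ℝ) ^ k * (3 / 5) ^ k = 1 := by
      rw [← mul_pow]
      norm_num
    simp only [dirac, sub_eq_iff_eq_add, zero_add]
    -- The coefficients are the corner fluxes of the harmonic part: `-2 * c` at the origin and `c`
    -- at each gluing point.
    linear_combination (c * (-2 * (if x = 0 ∧ y = 0 then (1 : ℝ) else 0) +
      (if x = 2 ^ k ∧ y = 0 then (1 : ℝ) else 0) +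
      (if x = 0 ∧ y = 2 ^ k then (1 : ℝ) else 0))) * hp
  · have := hv.mass_pos
    linarith

theorem exists_isLevelFun (k : ℕ) {n : ℤ} (hn : 0 < n) (hnk : n ≤ 2 ^ k) :
    ∃ u c, IsLevelFun k n u c := by
  induction k generalizing n with
  | zero =>
    obtain rfl : n = 1 := by
      rw [pow_zero] at hnk
      omega
    -- On one triangle with `n = 1`, the far corners need `u 0 0 = 2`; at the origin `-2 * 2 = 2 -
    -- c` then forces `c = 6`.
    refine ⟨fun x y => 2 * dirac 0 0 x y, 6, ⟨fun x y hxy hlt => ?_, fun x y hxy hle => ?_,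
      fun x y => ?_, by norm_num⟩⟩
    · have := iterVerts_region hxy
      have h : x = 0 ∧ y = 0 := by omega
      simp [dirac, h.1, h.2]
    · have h : ¬(x = 0 ∧ y = 0) := by omega
      simp [dirac, h]
    · have hb : belowLevel 1 (cellWeight 0) = cellWeight 0 := by
        ext a b
        exact belowLevel_eq_of_le (by simp) a b
      rw [hb]
      simp only [cellLap, cellCount, cellWeight, dirac, sub_eq_zero]
      by_cases h0 : x = 0 ∧ y = 0
      · obtain ⟨rfl, rfl⟩ := h0
        norm_num
      by_cases h1 : x = 1 ∧ y = 0
      · obtain ⟨rfl, rfl⟩ := h1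
        norm_num
      by_cases h2 : x = 0 ∧ y = 1
      · obtain ⟨rfl, rfl⟩ := h2
        norm_num
      simp [h0, h1, h2]
  | succ k ih =>
    rcases le_or_gt n (2 ^ k) with h | h
    · obtain ⟨u, c, hu⟩ := ih hn h
      exact ⟨_, _, hu.extend h⟩
    · rw [pow_succ] at hnk
      obtain ⟨u, c, hu⟩ := ih (n := n - 2 ^ k) (by omega) (by omega)
      obtain ⟨v, d, hv⟩ := ih (n := 2 ^ k) (by positivity) le_rfl
      have := hu.double (by omega) (by omega) hv
      rw [add_sub_cancel] at this
      exact ⟨_, _, this⟩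

/-! ### Cells and vertices of the infinite gasket -/

/-- `(a, b)` is the bottom left corner of a triangle of `SG⁺`. -/
def IsCell (a b : ℤ) : Prop := ∃ k, cellWeight k a b ≠ 0

/-- The point `(x, y)` is a corner of the triangle with bottom left corner `(a, b)`. -/
def InTri (a b x y : ℤ) : Prop := (x = a ∧ y = b) ∨ (x = a + 1 ∧ y = b) ∨ (x = a ∧ y = b + 1)

open Classical in
/-- The indicator function of the set of triangles of `SG⁺`. -/
noncomputable def cellInd (a b : ℤ) : ℝ := if IsCell a b then 1 else 0

theorem IsCell.nonneg {a b : ℤ} (h : IsCell a b) : 0 ≤ a ∧ 0 ≤ b := by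
  obtain ⟨k, hk⟩ := h
  have := cellWeight_support hk
  exact ⟨this.1, this.2.1⟩

theorem cellInd_eq_zero {a b : ℤ} (h : ¬(0 ≤ a ∧ 0 ≤ b)) : cellInd a b = 0 :=
  if_neg fun h' => h h'.nonneg

/-- The shifted copies lie at levels at least `2 ^ k`. Hence the triangles of the infinite gasket
below any given level can be read off from a finite stage. -/
theorem cellWeight_succ_of_lt {k : ℕ} {a b : ℤ} (h : a + b < 2 ^ k) :
    cellWeight (k + 1) a b = cellWeight k a b := by
  rw [cellWeight_succ, cellWeight_eq_zero (x := a - 2 ^ k) (by omega),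
    cellWeight_eq_zero (y := b - 2 ^ k) (by omega), add_zero, add_zero]

theorem cellWeight_of_le {k l : ℕ} (hkl : k ≤ l) {a b : ℤ} (h : a + b < 2 ^ k) :
    cellWeight l a b = cellWeight k a b := by
  induction l, hkl using Nat.le_induction with
  | base => rfl
  | succ l hl ih =>
    have : (2 : ℤ) ^ k ≤ 2 ^ l := pow_le_pow_right₀ (by norm_num) hl
    rw [cellWeight_succ_of_lt (by omega), ih]

theorem cellInd_eq_cellWeight {k : ℕ} {a b : ℤ} (h : a + b < 2 ^ k) :
    cellInd a b = cellWeight k a b := by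
  unfold cellInd
  split_ifs with hc
  · obtain ⟨l, hl⟩ := hc
    have := cellWeight_of_le (le_max_left k l) h
    rw [cellWeight_of_le (le_max_right k l) (cellWeight_support hl).2.2] at this
    rw [← this]
    exact ((cellWeight_zero_or_one l a b).resolve_left hl).symm
  · by_contra h'
    exact hc ⟨k, Ne.symm h'⟩

theorem mem_iterVerts_iff_exists {k : ℕ} {x y : ℤ} :
    (x, y) ∈ iterVerts k ↔ ∃ a b, cellWeight k a b ≠ 0 ∧ InTri a b x y := by
  rw [mem_iterVerts_iff_cellCount_ne_zero]
  constructor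
  · intro h
    by_cases h1 : cellWeight k x y = 0
    · by_cases h2 : cellWeight k (x - 1) y = 0
      · exact ⟨x, y - 1, fun h3 => h (by simp [cellCount, h1, h2, h3]), by simp [InTri]⟩
      · exact ⟨_, _, h2, by simp [InTri]⟩
    · exact ⟨_, _, h1, by simp [InTri]⟩
  · have h0 : ∀ a b, 0 ≤ cellWeight k a b := fun a b => by
      rcases cellWeight_zero_or_one k a b with h | h <;> simp [h]
    have a1 := h0 x y
    have a2 := h0 (x - 1) y
    have a3 := h0 x (y - 1)
    rintro ⟨a, b, hab, h⟩
    have hp := (h0 a b).lt_of_ne' hab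
    unfold cellCount
    rcases h with ⟨rfl, rfl⟩ | ⟨rfl, rfl⟩ | ⟨rfl, rfl⟩
    · positivity
    · rw [add_sub_cancel_right] at *
      positivity
    · rw [add_sub_cancel_right] at *
      positivity

theorem mem_plusVerts_iff {x y : ℤ} : (x, y) ∈ plusVerts ↔ ∃ a b, IsCell a b ∧ InTri a b x y := by
  simp only [plusVerts, Set.mem_iUnion, mem_iterVerts_iff_exists, IsCell]
  constructor
  · rintro ⟨k, a, b, h, h'⟩
    exact ⟨a, b, ⟨k, h⟩, h'⟩
  · rintro ⟨a, b, ⟨k, h⟩, h'⟩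
    exact ⟨k, a, b, h, h'⟩

theorem mem_verts_iff {x y : ℤ} : (x, y) ∈ verts ↔ (x, y) ∈ plusVerts ∨ (-x, -y) ∈ plusVerts := by
  simp [verts]

theorem nonneg_of_mem_plusVerts {x y : ℤ} (h : (x, y) ∈ plusVerts) : 0 ≤ x ∧ 0 ≤ y := by
  obtain ⟨k, hk⟩ := Set.mem_iUnion.1 h
  have := iterVerts_region hk
  exact ⟨this.1, this.2.1⟩

theorem iterGraph_adj_iff {k : ℕ} {x y x' y' : ℤ} : (iterGraph k).Adj (x, y) (x', y') ↔
    (x, y) ≠ (x', y') ∧ ∃ a b, cellWeight k a b ≠ 0 ∧ InTri a b x y ∧ InTri a b x' y' := by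
  induction k generalizing x y x' y' with
  | zero =>
    simp only [iterGraph, SimpleGraph.fromRel_adj]
    refine and_congr_right fun _ => ?_
    have hb : ∀ x y : ℤ, (x, y) ∈ baseTriangle ↔ InTri 0 0 x y := fun x y => by
      simp [baseTriangle, InTri]
    simp only [hb, cellWeight]
    constructor
    · intro h
      exact ⟨0, 0, by simp, by tauto⟩
    · rintro ⟨a, b, hab, h⟩
      simp only [ne_eq, ite_eq_right_iff, one_ne_zero, imp_false, not_not] at hab
      rw [hab.1, hab.2] at h
      exact Or.inl h
  | succ k ih =>
    have hs : ∀ s : ℤ × ℤ, ((iterGraph k).map (Equiv.addRight s).toEmbedding).Adj (x, y) (x', y') ↔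
        (iterGraph k).Adj (x - s.1, y - s.2) (x' - s.1, y' - s.2) := fun s => by
      rw [SimpleGraph.map_adj]
      constructor
      · rintro ⟨u, v, h, hu, hv⟩
        simp only [Equiv.coe_toEmbedding, Equiv.coe_addRight, Prod.ext_iff, Prod.fst_add,
          Prod.snd_add] at hu hv
        convert h using 1 <;> ext <;> simp <;> omega
      · intro h
        exact ⟨_, _, h, by ext <;> simp, by ext <;> simp⟩
    have ht : ∀ a b s t x y : ℤ, InTri a b (x - s) (y - t) ↔ InTri (a + s) (b + t) x y :=
      fun a b s t x y => by
        unfold InTri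
        omega
    simp only [iterGraph, SimpleGraph.iSup_adj, hs, ih, Fin.exists_fin_succ, shift, ht]
    simp only [Matrix.cons_val_zero, Matrix.cons_val_succ, Fin.succ_zero_eq_one, sub_zero,
      Matrix.cons_val_one, IsEmpty.exists_iff, or_false, ne_eq, Prod.mk.injEq, add_zero,
      sub_left_inj, ← and_or_left]
    refine and_congr_right fun _ => ?_
    constructor
    · rintro (⟨a, b, h, h'⟩ | ⟨a, b, h, h'⟩ | ⟨a, b, h, h'⟩)
      · refine ⟨a, b, ?_, h'⟩
        rwa [cellWeight_succ_of_lt (cellWeight_support h).2.2]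
      · refine ⟨_, _, ?_, h'⟩
        have := cellWeight_support h
        rw [cellWeight_succ, cellWeight_eq_zero (by omega), cellWeight_eq_zero (y := b - _) (by omega)]
        simpa using h
      · refine ⟨_, _, ?_, h'⟩
        have := cellWeight_support h
        rw [cellWeight_succ, cellWeight_eq_zero (by omega), cellWeight_eq_zero (x := a - _) (by omega)]
        simpa using h
    · rintro ⟨a, b, h, h'⟩
      by_cases h1 : cellWeight k a b = 0
      · by_cases h2 : cellWeight k (a - 2 ^ k) b = 0
        · exact Or.inr (Or.inr ⟨a, b - 2 ^ k, fun h3 => h (by simp [cellWeight, h1, h2, h3]),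
            by simpa using h'⟩)
        · exact Or.inr (Or.inl ⟨_, _, h2, by simpa using h'⟩)
      · exact Or.inl ⟨_, _, h1, h'⟩

theorem fullGraph_adj_iff {x y x' y' : ℤ} : fullGraph.Adj (x, y) (x', y') ↔
    (x, y) ≠ (x', y') ∧ ∃ a b, IsCell a b ∧ ((InTri a b x y ∧ InTri a b x' y') ∨
      (InTri a b (-x) (-y) ∧ InTri a b (-x') (-y'))) := by
  have hp : ∀ x y x' y' : ℤ, plusGraph.Adj (x, y) (x', y') ↔
      (x, y) ≠ (x', y') ∧ ∃ a b, IsCell a b ∧ InTri a b x y ∧ InTri a b x' y' :=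
    fun x y x' y' => by
      simp only [plusGraph, SimpleGraph.iSup_adj, iterGraph_adj_iff, IsCell]
      constructor
      · rintro ⟨k, hne, a, b, h, h'⟩
        exact ⟨hne, a, b, ⟨k, h⟩, h'⟩
      · rintro ⟨hne, a, b, ⟨k, h⟩, h'⟩
        exact ⟨k, hne, a, b, h, h'⟩
  have hn : (plusGraph.map (Equiv.neg (ℤ × ℤ)).toEmbedding).Adj (x, y) (x', y') ↔
      plusGraph.Adj (-x, -y) (-x', -y') := by
    rw [SimpleGraph.map_adj]
    constructor
    · rintro ⟨u, v, h, hu, hv⟩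
      simp only [Equiv.coe_toEmbedding, Equiv.neg_apply, Prod.ext_iff, Prod.fst_neg,
        Prod.snd_neg] at hu hv
      convert h using 1 <;> ext <;> simp <;> omega
    · intro h
      exact ⟨_, _, h, by simp, by simp⟩
  rw [fullGraph, SimpleGraph.sup_adj, hn, hp, hp]
  simp only [ne_eq, Prod.mk.injEq, neg_inj, ← and_or_left, ← exists_or]

theorem mem_verts_of_isCell {a b x y : ℤ} (h : IsCell a b)
    (h' : InTri a b x y ∨ InTri a b (-x) (-y)) : (x, y) ∈ verts := by
  rw [mem_verts_iff, mem_plusVerts_iff, mem_plusVerts_iff]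
  exact h'.imp (fun h' => ⟨a, b, h, h'⟩) fun h' => ⟨a, b, h, h'⟩

/-! ### Sums over neighbours -/

/-- The weighted sum of `f p` over all other corners `p` of the triangles containing `(x, y)`. -/
def cellSum (w f : ℤ → ℤ → ℝ) (x y : ℤ) : ℝ :=
  w x y * (f (x + 1) y + f x (y + 1)) +
  w (x - 1) y * (f (x - 1) y + f (x - 1) (y + 1)) +
  w x (y - 1) * (f x (y - 1) + f (x + 1) (y - 1))

theorem cellLap_eq (w f : ℤ → ℤ → ℝ) (x y : ℤ) :
    cellLap w f x y = cellSum w f x y - 2 * cellCount w x y * f x y := by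
  simp only [cellLap, cellSum, cellCount]
  ring

/-- Triangles of `SG⁺` have nonnegative corners, so the two alternatives exclude each other and a
disjunction between the two halves becomes a sum of indicators. -/
theorem cellInd_or (a b a' b' : ℤ) [Decidable (IsCell a b ∨ IsCell a' b')]
    (h : ¬(0 ≤ a ∧ 0 ≤ b) ∨ ¬(0 ≤ a' ∧ 0 ≤ b')) (z : ℝ) :
    (if IsCell a b ∨ IsCell a' b' then z else 0) = (cellInd a b + cellInd a' b') * z := by
  by_cases h1 : IsCell a b
  · have h2 : ¬IsCell a' b' := fun h2 => h.elim (· h1.nonneg) (· h2.nonneg)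
    simp [cellInd, h1, h2]
  · by_cases h2 : IsCell a' b' <;> simp [cellInd, h1, h2]

/-- Each of the six possible directions of an edge determines a unique triangle containing it in
each half of the gasket. -/
theorem fullGraph_adj_cases (x y : ℤ) :
    (fullGraph.Adj (x, y) (x + 1, y) ↔ IsCell x y ∨ IsCell (-x - 1) (-y)) ∧
    (fullGraph.Adj (x, y) (x, y + 1) ↔ IsCell x y ∨ IsCell (-x) (-y - 1)) ∧
    (fullGraph.Adj (x, y) (x - 1, y) ↔ IsCell (x - 1) y ∨ IsCell (-x) (-y)) ∧
    (fullGraph.Adj (x, y) (x - 1, y + 1) ↔ IsCell (x - 1) y ∨ IsCell (-x) (-y - 1)) ∧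
    (fullGraph.Adj (x, y) (x, y - 1) ↔ IsCell x (y - 1) ∨ IsCell (-x) (-y)) ∧
    (fullGraph.Adj (x, y) (x + 1, y - 1) ↔ IsCell x (y - 1) ∨ IsCell (-x - 1) (-y)) := by
  have key : ∀ x' y' a b a' b' : ℤ, (x, y) ≠ (x', y') →
      (∀ c d, InTri c d x y ∧ InTri c d x' y' ↔ c = a ∧ d = b) →
      (∀ c d, InTri c d (-x) (-y) ∧ InTri c d (-x') (-y') ↔ c = a' ∧ d = b') →
      (fullGraph.Adj (x, y) (x', y') ↔ IsCell a b ∨ IsCell a' b') := by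
    intro x' y' a b a' b' hne h1 h2
    simp only [fullGraph_adj_iff, h1, h2]
    constructor
    · rintro ⟨-, c, d, hc, ⟨rfl, rfl⟩ | ⟨rfl, rfl⟩⟩
      · exact Or.inl hc
      · exact Or.inr hc
    · rintro (h | h)
      · exact ⟨hne, a, b, h, Or.inl ⟨rfl, rfl⟩⟩
      · exact ⟨hne, a', b', h, Or.inr ⟨rfl, rfl⟩⟩
  refine ⟨?_, ?_, ?_, ?_, ?_, ?_⟩ <;> apply key <;>
    first
    | (simp only [ne_eq, Prod.mk.injEq]; omega)
    | (intro c d; unfold InTri; omega)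

/-- This passes from the graph to the triangle calculus: the negative half is handled by evaluating
the reflected function at `-v`. -/
theorem sum_neighborFinset (v : verts) (f : ℤ → ℤ → ℝ) :
    ∑ q ∈ SG.neighborFinset v, f q.1.1 q.1.2 = cellSum cellInd f v.1.1 v.1.2 +
      cellSum cellInd (fun a b => f (-a) (-b)) (-v.1.1) (-v.1.2) := by
  classical
  obtain ⟨⟨x, y⟩, hv⟩ := v
  set cand : Finset (ℤ × ℤ) :=
    {(x + 1, y), (x, y + 1), (x - 1, y), (x - 1, y + 1), (x, y - 1), (x + 1, y - 1)} with hcand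
  have hmap : (SG.neighborFinset ⟨(x, y), hv⟩).map (Function.Embedding.subtype _) =
      cand.filter (fun q => fullGraph.Adj (x, y) q) := by
    ext ⟨x', y'⟩
    simp only [Finset.mem_map, SimpleGraph.mem_neighborFinset, Function.Embedding.subtype_apply,
      Finset.mem_filter]
    constructor
    · rintro ⟨⟨q, hq⟩, hadj, rfl⟩
      have hadj' : fullGraph.Adj (x, y) (x', y') := hadj
      refine ⟨?_, hadj'⟩
      obtain ⟨hne, a, b, -, h⟩ := fullGraph_adj_iff.1 hadj'
      simp only [hcand, Finset.mem_insert, Finset.mem_singleton, Prod.mk.injEq, ne_eq, InTri]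
        at hne h ⊢
      omega
    · rintro ⟨-, hadj⟩
      obtain ⟨hne, a, b, hc, h⟩ := fullGraph_adj_iff.1 hadj
      exact ⟨⟨(x', y'), mem_verts_of_isCell hc (h.imp And.right And.right)⟩, hadj, rfl⟩
  have hsum := Finset.sum_map (SG.neighborFinset ⟨(x, y), hv⟩) (Function.Embedding.subtype _)
    (fun q => f q.1 q.2)
  simp only [Function.Embedding.subtype_apply] at hsum
  rw [← hsum, hmap, Finset.sum_filter, hcand]
  obtain ⟨h1, h2, h3, h4, h5, h6⟩ := fullGraph_adj_cases x y
  rw [Finset.sum_insert (by simp; try omega), Finset.sum_insert (by simp; try omega),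
    Finset.sum_insert (by simp; try omega),
    Finset.sum_insert (by simp; try omega), Finset.sum_insert (by simp; try omega),
    Finset.sum_singleton]
  simp only [h1, h2, h3, h4, h5, h6]
  rw [cellInd_or _ _ _ _ (by omega), cellInd_or _ _ _ _ (by omega), cellInd_or _ _ _ _ (by omega),
    cellInd_or _ _ _ _ (by omega), cellInd_or _ _ _ _ (by omega), cellInd_or _ _ _ _ (by omega)]
  have e1 : ∀ z : ℤ, -(-z + 1) = z - 1 := fun z => by ring
  have e2 : ∀ z : ℤ, -(-z - 1) = z + 1 := fun z => by ring
  simp only [cellSum, e1, e2, neg_neg]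
  ring

/-! ### Every vertex lies in exactly two triangles -/

theorem cellInd_zero_or_one (a b : ℤ) : cellInd a b = 0 ∨ cellInd a b = 1 := by
  unfold cellInd
  split_ifs <;> simp

theorem cellCount_eq_zero_of_neg {x y : ℤ} (h : x + y < 0) : cellCount cellInd x y = 0 := by
  unfold cellCount
  rw [cellInd_eq_zero (by omega), cellInd_eq_zero (by omega), cellInd_eq_zero (by omega)]
  simp

theorem isCell_zero : IsCell 0 0 := ⟨0, by simp [cellWeight]⟩

theorem cellCount_zero : cellCount cellInd 0 0 = 1 := by
  unfold cellCount
  rw [cellInd_eq_zero (a := 0 - 1) (by omega), cellInd_eq_zero (b := 0 - 1) (by omega)]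
  simp [cellInd, isCell_zero]

theorem cellCount_eq_two {x y : ℤ} (h : (x, y) ∈ plusVerts) (h0 : x + y ≠ 0) :
    cellCount cellInd x y = 2 := by
  obtain ⟨k, hk⟩ : ∃ k : ℕ, x + y < 2 ^ k := by
    obtain ⟨k, hk⟩ := pow_unbounded_of_one_lt (x + y) (by norm_num : (1 : ℤ) < 2)
    exact ⟨k, hk⟩
  have hc : cellCount cellInd x y = cellCount (cellWeight k) x y := by
    unfold cellCount
    rw [cellInd_eq_cellWeight (k := k) (by omega), cellInd_eq_cellWeight (k := k) (by omega),
      cellInd_eq_cellWeight (k := k) (by omega)]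
  -- With `x + y` strictly between `0` and `2 ^ k`, the point is no corner of `G_k`, so its count is
  -- even; being positive and at most `3`, it is `2`.
  obtain ⟨j, hj⟩ := cellCount_parity k x y
  have d1 : dirac 0 0 x y = 0 := if_neg (by omega)
  have d2 : dirac (2 ^ k) 0 x y = 0 := if_neg (by omega)
  have d3 : dirac 0 (2 ^ k) x y = 0 := if_neg (by omega)
  rw [d1, d2, d3, ← hc, add_zero, add_zero, add_zero] at hj
  have hpos : 0 < cellCount cellInd x y := by
    obtain ⟨a, b, hab, ht⟩ := mem_plusVerts_iff.1 h
    have hnn : ∀ a b, 0 ≤ cellInd a b := fun a b => by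
      rcases cellInd_zero_or_one a b with h | h <;> simp [h]
    have a1 := hnn x y
    have a2 := hnn (x - 1) y
    have a3 := hnn x (y - 1)
    have hp : cellInd a b = 1 := if_pos hab
    unfold cellCount
    rcases ht with ⟨rfl, rfl⟩ | ⟨rfl, rfl⟩ | ⟨rfl, rfl⟩
    · linarith
    · rw [add_sub_cancel_right] at *
      linarith
    · rw [add_sub_cancel_right] at *
      linarith
  have hle : cellCount cellInd x y ≤ 3 := by
    have hle1 : ∀ a b, cellInd a b ≤ 1 := fun a b => by
      rcases cellInd_zero_or_one a b with h | h <;> simp [h]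
    have a1 := hle1 x y
    have a2 := hle1 (x - 1) y
    have a3 := hle1 x (y - 1)
    unfold cellCount
    linarith
  rw [hj] at hpos hle ⊢
  have j1 : 0 < j := by exact_mod_cast (by linarith : (0 : ℝ) < j)
  have j2 : j < 2 := by exact_mod_cast (by linarith : (j : ℝ) < 2)
  obtain rfl : j = 1 := by omega
  norm_num

theorem eq_zero_of_mem_plusVerts {x y : ℤ} (h : (x, y) ∈ plusVerts) (h0 : x + y = 0) :
    x = 0 ∧ y = 0 := by
  have := nonneg_of_mem_plusVerts h
  omega

/-- The signed distance of a vertex from the origin. -/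
def level (v : verts) : ℤ := v.1.1 + v.1.2

theorem eq_origin_of_level_eq_zero {v : verts} (h : level v = 0) : v = origin := by
  obtain ⟨⟨x, y⟩, hv⟩ := v
  have h' : x + y = 0 := h
  apply Subtype.ext
  rcases mem_verts_iff.1 hv with h1 | h1
  · have := eq_zero_of_mem_plusVerts h1 h'
    simp [origin, this]
  · have := eq_zero_of_mem_plusVerts h1 (by omega)
    simp only [neg_eq_zero] at this
    simp [origin, this]

theorem level_origin : level origin = 0 := rfl

theorem mem_plusVerts_of_level_pos {v : verts} (h : 0 < level v) : (v.1.1, v.1.2) ∈ plusVerts := by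
  obtain ⟨⟨x, y⟩, hv⟩ := v
  have h' : 0 < x + y := h
  refine (mem_verts_iff.1 hv).resolve_right fun h1 => ?_
  have := nonneg_of_mem_plusVerts h1
  omega

theorem mem_plusVerts_of_level_neg {v : verts} (h : level v < 0) :
    (-v.1.1, -v.1.2) ∈ plusVerts := by
  obtain ⟨⟨x, y⟩, hv⟩ := v
  have h' : x + y < 0 := h
  refine (mem_verts_iff.1 hv).resolve_left fun h1 => ?_
  have := nonneg_of_mem_plusVerts h1
  omega

theorem cellCount_add_cellCount_neg (v : verts) :
    cellCount cellInd v.1.1 v.1.2 + cellCount cellInd (-v.1.1) (-v.1.2) = 2 := by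
  rcases lt_trichotomy (level v) 0 with h | h | h
  · have h' := h
    unfold level at h'
    rw [cellCount_eq_zero_of_neg (by omega),
      cellCount_eq_two (mem_plusVerts_of_level_neg h) (by omega), zero_add]
  · rw [eq_origin_of_level_eq_zero h]
    simp only [origin, neg_zero, cellCount_zero]
    norm_num
  · have h' := h
    unfold level at h'
    rw [cellCount_eq_zero_of_neg (x := -v.1.1) (by omega),
      cellCount_eq_two (mem_plusVerts_of_level_pos h) (by omega), add_zero]

theorem card_neighborFinset (v : verts) : ((SG.neighborFinset v).card : ℝ) = 4 := by
  have h := sum_neighborFinset v (fun _ _ => 1)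
  have hc : ∀ x y, cellSum cellInd (fun _ _ => 1) x y = 2 * cellCount cellInd x y := fun x y => by
    simp only [cellSum, cellCount]
    ring
  rw [hc, hc, ← mul_add, cellCount_add_cellCount_neg] at h
  rw [Finset.card_eq_sum_ones]
  push_cast
  rw [h]
  norm_num

/-! ### Balls and their boundaries -/

theorem SG_adj_iff {u v : verts} : SG.Adj u v ↔ u.1 ≠ v.1 ∧ ∃ a b, IsCell a b ∧
    ((InTri a b u.1.1 u.1.2 ∧ InTri a b v.1.1 v.1.2) ∨
      (InTri a b (-u.1.1) (-u.1.2) ∧ InTri a b (-v.1.1) (-v.1.2))) :=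
  fullGraph_adj_iff

theorem abs_level_le_of_adj {u v : verts} (h : SG.Adj u v) : |level v| ≤ |level u| + 1 := by
  obtain ⟨-, a, b, -, h⟩ := SG_adj_iff.1 h
  simp only [InTri] at h
  unfold level
  simp only [Int.abs_eq_natAbs]
  omega

theorem abs_level_le_of_walk {u v : verts} (p : SG.Walk u v) :
    |level v| ≤ |level u| + p.length := by
  induction p with
  | nil => simp
  | cons h p ih =>
    have := abs_level_le_of_adj h
    rw [SimpleGraph.Walk.length_cons]
    push_cast
    omega

/-- Of the two triangles at the vertex only one can have it as its bottom left corner; the other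
leads one level down. -/
theorem isCell_of_mem_plusVerts {x y : ℤ} (h : (x, y) ∈ plusVerts) (h0 : x + y ≠ 0) :
    IsCell (x - 1) y ∨ IsCell x (y - 1) := by
  by_contra! h'
  have := cellCount_eq_two h h0
  unfold cellCount at this
  rw [show cellInd (x - 1) y = 0 from if_neg h'.1, show cellInd x (y - 1) = 0 from if_neg h'.2]
    at this
  rcases cellInd_zero_or_one x y with h1 | h1 <;> rw [h1] at this <;> norm_num at this

theorem exists_adj_level_lt {v : verts} (h : v ≠ origin) :
    ∃ u, SG.Adj u v ∧ |level v| = |level u| + 1 := by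
  have key : ∀ x' y' a b : ℤ, IsCell a b → (v.1.1, v.1.2) ≠ (x', y') →
      ((InTri a b v.1.1 v.1.2 ∧ InTri a b x' y') ∨
        (InTri a b (-v.1.1) (-v.1.2) ∧ InTri a b (-x') (-y'))) → |level v| = |x' + y'| + 1 →
      ∃ u, SG.Adj u v ∧ |level v| = |level u| + 1 := fun x' y' a b hc hne ht hl =>
    ⟨⟨(x', y'), mem_verts_of_isCell hc (ht.imp And.right And.right)⟩,
      SimpleGraph.Adj.symm (SG_adj_iff.2 ⟨hne, a, b, hc, ht⟩), hl⟩
  rcases lt_trichotomy (level v) 0 with h' | h' | h'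
  · have hl := h'
    unfold level at hl
    rcases isCell_of_mem_plusVerts (mem_plusVerts_of_level_neg h') (by omega) with hc | hc
    · have := hc.nonneg
      refine key (v.1.1 + 1) v.1.2 _ _ hc (by simp only [ne_eq, Prod.mk.injEq]; omega) (Or.inr ?_) ?_
      · unfold InTri
        omega
      · unfold level
        simp only [Int.abs_eq_natAbs]
        omega
    · have := hc.nonneg
      refine key v.1.1 (v.1.2 + 1) _ _ hc (by simp only [ne_eq, Prod.mk.injEq]; omega) (Or.inr ?_) ?_
      · unfold InTri
        omega
      · unfold level
        simp only [Int.abs_eq_natAbs]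
        omega
  · exact absurd (eq_origin_of_level_eq_zero h') h
  · have hl := h'
    unfold level at hl
    rcases isCell_of_mem_plusVerts (mem_plusVerts_of_level_pos h') (by omega) with hc | hc
    · have := hc.nonneg
      refine key (v.1.1 - 1) v.1.2 _ _ hc (by simp only [ne_eq, Prod.mk.injEq]; omega) (Or.inl ?_) ?_
      · unfold InTri
        omega
      · unfold level
        simp only [Int.abs_eq_natAbs]
        omega
    · have := hc.nonneg
      refine key v.1.1 (v.1.2 - 1) _ _ hc (by simp only [ne_eq, Prod.mk.injEq]; omega) (Or.inl ?_) ?_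
      · unfold InTri
        omega
      · unfold level
        simp only [Int.abs_eq_natAbs]
        omega

theorem exists_walk (v : verts) : ∃ p : SG.Walk origin v, (p.length : ℤ) = |level v| := by
  obtain ⟨l, hl⟩ : ∃ l : ℕ, (l : ℤ) = |level v| := ⟨(level v).natAbs, by simp⟩
  induction l generalizing v with
  | zero =>
    obtain rfl := eq_origin_of_level_eq_zero (v := v) (by simpa using hl.symm)
    exact ⟨.nil, by simpa using hl⟩
  | succ l ih =>
    have hv : v ≠ origin := by
      rintro rfl
      rw [level_origin, abs_zero] at hl
      omega
    obtain ⟨u, hadj, hu⟩ := exists_adj_level_lt hv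
    obtain ⟨p, hp⟩ := ih u (by omega)
    refine ⟨p.concat hadj, ?_⟩
    rw [SimpleGraph.Walk.length_concat]
    push_cast
    omega

theorem SG_preconnected : SG.Preconnected := fun u v =>
  (exists_walk u).choose.reachable.symm.trans (exists_walk v).choose.reachable

/-- Graph distance equals `|level|`: `exists_walk` descends one level per step, and no edge changes
`|level|` by more than one. -/
theorem mem_ball_iff {r : ℤ} {v : verts} : v ∈ ball r ↔ |level v| ≤ r := by
  obtain ⟨p, hp⟩ := exists_walk v
  have hle : (SG.dist origin v : ℤ) ≤ |level v| := by
    rw [← hp]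
    exact_mod_cast SimpleGraph.dist_le p
  have hge : |level v| ≤ SG.dist origin v := by
    obtain ⟨q, hq⟩ := p.reachable.exists_walk_length_eq_dist
    have := abs_level_le_of_walk q
    rw [level_origin, abs_zero, hq] at this
    omega
  constructor
  · rintro ⟨-, h⟩
    omega
  · intro h
    exact ⟨p.reachable, by omega⟩

theorem finite_ball (r : ℤ) : (ball r).Finite := by
  have hf : (Set.Icc (-r) r ×ˢ Set.Icc (-r) r).Finite := (Set.finite_Icc _ _).prod (Set.finite_Icc _ _)
  refine (hf.preimage (f := (Subtype.val : verts → ℤ × ℤ)) Subtype.val_injective.injOn).subset ?_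
  rintro ⟨⟨x, y⟩, hv⟩ h
  have h' : |x + y| ≤ r := mem_ball_iff.1 h
  simp only [Set.mem_preimage, Set.mem_prod, Set.mem_Icc]
  rw [Int.abs_eq_natAbs] at h'
  rcases mem_verts_iff.1 hv with h1 | h1 <;> have := nonneg_of_mem_plusVerts h1 <;> omega

/-- Not every vertex at distance `r` is on the boundary: an edge leaves the ball exactly when the
vertex is the corner nearest the origin of some triangle. -/
theorem mem_innerBoundary_ball_iff {r : ℤ} (hr : 0 ≤ r) {v : verts} : v ∈ innerBoundary (ball r) ↔
    |level v| = r ∧ (IsCell v.1.1 v.1.2 ∨ IsCell (-v.1.1) (-v.1.2)) := by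
  constructor
  · rintro ⟨hv, q, hq, hadj⟩
    rw [mem_ball_iff] at hv hq
    obtain ⟨hne, a, b, hc, h⟩ := SG_adj_iff.1 hadj
    have := hc.nonneg
    unfold level at hv hq ⊢
    simp only [Int.abs_eq_natAbs] at hv hq ⊢
    rcases h with h | h
    · obtain ⟨h1, h2⟩ : v.1.1 = a ∧ v.1.2 = b := by
        simp only [InTri] at h
        omega
      refine ⟨?_, Or.inl (by rwa [h1, h2])⟩
      simp only [InTri] at h
      omega
    · obtain ⟨h1, h2⟩ : -v.1.1 = a ∧ -v.1.2 = b := by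
        simp only [InTri] at h
        omega
      refine ⟨?_, Or.inr (by rwa [h1, h2])⟩
      simp only [InTri] at h
      omega
  · rintro ⟨hl, hc⟩
    refine ⟨mem_ball_iff.2 hl.le, ?_⟩
    unfold level at hl
    rw [Int.abs_eq_natAbs] at hl
    rcases hc with hc | hc
    · have := hc.nonneg
      have ht : InTri v.1.1 v.1.2 (v.1.1 + 1) v.1.2 := by simp [InTri]
      refine ⟨⟨(v.1.1 + 1, v.1.2), mem_verts_of_isCell hc (Or.inl ht)⟩, ?_, SG_adj_iff.2
        ⟨?_, _, _, hc, Or.inl ⟨by simp [InTri], ht⟩⟩⟩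
      · rw [mem_ball_iff, level]
        simp only [Int.abs_eq_natAbs]
        omega
      · intro h
        have h' : v.1.1 = v.1.1 + 1 := congrArg Prod.fst h
        omega
    · have := hc.nonneg
      have ht : InTri (-v.1.1) (-v.1.2) (-(v.1.1 - 1)) (-v.1.2) :=
        Or.inr (Or.inl ⟨by ring, rfl⟩)
      refine ⟨⟨(v.1.1 - 1, v.1.2), mem_verts_of_isCell hc (Or.inr ht)⟩, ?_, SG_adj_iff.2
        ⟨?_, _, _, hc, Or.inr ⟨by simp [InTri], ht⟩⟩⟩
      · rw [mem_ball_iff, level]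
        simp only [Int.abs_eq_natAbs]
        omega
      · intro h
        have h' : v.1.1 = v.1.1 - 1 := congrArg Prod.fst h
        omega

/-! ### The odometer functions of balls -/

theorem mem_iterVerts_of_lt {k : ℕ} {x y : ℤ} (h : (x, y) ∈ plusVerts) (hk : x + y < 2 ^ k) :
    (x, y) ∈ iterVerts k := by
  obtain ⟨a, b, hab, ht⟩ := mem_plusVerts_iff.1 h
  refine mem_iterVerts_iff_exists.2 ⟨a, b, ?_, ht⟩
  have h1 : cellInd a b = 1 := if_pos hab
  unfold InTri at ht
  rw [← cellInd_eq_cellWeight (by omega), h1]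
  exact one_ne_zero

/-- The function of `exists_isLevelFun`, extended by zero to the one-sided gasket. -/
theorem exists_plusLevelFun {n : ℕ} (hn : 0 < n) : ∃ (u : ℤ → ℤ → ℝ) (c : ℝ),
    (∀ x y, (x, y) ∈ plusVerts → x + y < n → 0 < u x y) ∧ (∀ x y, (n : ℤ) ≤ x + y → u x y = 0) ∧
    ∀ x y, cellLap cellInd u x y =
      2 * cellCount (belowLevel n cellInd) x y - c * dirac 0 0 x y := by
  have hnk : (n : ℤ) < 2 ^ n := by exact_mod_cast Nat.lt_two_pow_self
  obtain ⟨u, c, hu⟩ := exists_isLevelFun n (n := n) (by exact_mod_cast hn) hnk.le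
  set u' : ℤ → ℤ → ℝ := fun x y => if x + y < n then u x y else 0 with hu'
  have hz : ∀ x y, (n : ℤ) ≤ x + y → u' x y = 0 := fun x y h => if_neg (by omega)
  refine ⟨u', c, fun x y h hlt => ?_, hz, fun x y => ?_⟩
  · simp only [hu', hlt, if_true]
    exact hu.pos _ _ (mem_iterVerts_of_lt h (by omega)) hlt
  -- Triangles of the infinite gasket missing from `G_n` start at level at least `2 ^ n > n`, where
  -- the truncated function vanishes on all three corners.
  · have h1 : ∀ a b t, ((n : ℤ) ≤ a + b → t = 0) →
        cellInd a b * t = cellWeight n a b * t := fun a b t ht => by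
      rcases lt_or_ge (a + b) (n : ℤ) with h | h
      · rw [cellInd_eq_cellWeight (k := n) (by omega)]
      · rw [ht h, mul_zero, mul_zero]
    have h2 : cellLap cellInd u' x y = cellLap (cellWeight n) u' x y := by
      unfold cellLap
      rw [h1, h1, h1] <;> intro h <;> rw [hz _ _ (by omega), hz _ _ (by omega), hz _ _ (by omega)] <;>
        norm_num
    have h3 : cellLap (cellWeight n) u' x y = cellLap (cellWeight n) u x y := by
      have h4 : ∀ a b, (a, b) ∈ iterVerts n → u' a b = u a b := fun a b h => by
        simp only [hu']
        split_ifs with hlt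
        · rfl
        · exact (hu.eq_zero _ _ h (by omega)).symm
      refine cellLap_congr (fun a b hab => ⟨h4 _ _ ?_, h4 _ _ ?_, h4 _ _ ?_⟩) x y <;>
        exact mem_iterVerts_iff_exists.2 ⟨a, b, hab, by simp [InTri]⟩
    have h5 : belowLevel n cellInd = belowLevel n (cellWeight n) := by
      ext a b
      unfold belowLevel
      split_ifs with h
      · exact cellInd_eq_cellWeight (by omega)
      · rfl
    rw [h2, h3, hu.lap, h5]

/-- The `1/2` in `ballMass` originates here: at level exactly `n` the triangle pointing outwards, if
there is one, is not counted, so a boundary vertex keeps one of its two triangles. -/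
theorem cellCount_belowLevel {n x y : ℤ} (h : (x, y) ∈ plusVerts) (h0 : x + y ≠ 0) :
    cellCount (belowLevel n cellInd) x y =
      2 * (if x + y ≤ n then 1 else 0) - if x + y = n then cellInd x y else 0 := by
  have h2 := cellCount_eq_two h h0
  unfold cellCount belowLevel at *
  rcases lt_trichotomy (x + y) n with hlt | heq | hgt
  · rw [if_pos hlt, if_pos (by omega), if_pos (by omega), if_pos (by omega), if_neg (by omega), h2]
    norm_num
  · rw [if_neg (by omega), if_pos (by omega), if_pos (by omega), if_pos (by omega),
      if_pos (by omega)]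
    linarith
  · rw [if_neg (by omega), if_neg (by omega), if_neg (by omega), if_neg (by omega),
      if_neg (by omega)]
    norm_num

theorem cellSum_eq_zero_of_neg (f : ℤ → ℤ → ℝ) {x y : ℤ} (h : x + y < 0) :
    cellSum cellInd f x y = 0 := by
  unfold cellSum
  rw [cellInd_eq_zero (by omega), cellInd_eq_zero (by omega), cellInd_eq_zero (by omega)]
  simp

theorem indicator_ball (r : ℤ) (v : verts) :
    (ball r).indicator (1 : verts → ℝ) v = if |level v| ≤ r then 1 else 0 := by
  classical
  simp [Set.indicator_apply, mem_ball_iff]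

/-- The origin is excluded because it is the lowest corner of a triangle in both halves, and the sum
there would be `2`. -/
theorem indicator_innerBoundary_ball {r : ℤ} (hr : 0 ≤ r) {v : verts} (hv : v ≠ origin) :
    (innerBoundary (ball r)).indicator (1 : verts → ℝ) v =
      if |level v| = r then cellInd v.1.1 v.1.2 + cellInd (-v.1.1) (-v.1.2) else 0 := by
  classical
  have h0 : level v ≠ 0 := fun h => hv (eq_origin_of_level_eq_zero h)
  simp only [Set.indicator_apply, mem_innerBoundary_ball_iff hr, Pi.one_apply]
  by_cases hl : |level v| = r
  · simp only [hl, true_and, if_true]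
    rw [cellInd_or _ _ _ _ (by unfold level at h0; omega), mul_one]
  · simp [hl]

theorem exists_ballFun_aux (n : ℕ) : ∃ (U : verts → ℝ) (c : ℝ),
    (∀ v, |level v| < n → 0 < U v) ∧ (∀ v, (n : ℤ) ≤ |level v| → U v = 0) ∧
    ∀ v, laplacian U v = (ball n).indicator 1 v -
      1 / 2 * (innerBoundary (ball n)).indicator 1 v - c * (Pi.single origin 1 : verts → ℝ) v := by
  obtain ⟨U, hpos, hzero, hlap⟩ : ∃ (U : verts → ℝ),
    (∀ v, |level v| < n → 0 < U v) ∧ (∀ v, (n : ℤ) ≤ |level v| → U v = 0) ∧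
    ∀ v, v ≠ origin → laplacian U v = (ball n).indicator 1 v -
      1 / 2 * (innerBoundary (ball n)).indicator 1 v := by
    rcases Nat.eq_zero_or_pos n with rfl | hn
    · refine ⟨0, fun v hv => absurd hv (by simp), fun v _ => rfl, fun v hv => ?_⟩
      have h0 : level v ≠ 0 := fun h => hv (eq_origin_of_level_eq_zero h)
      rw [indicator_ball, Nat.cast_zero, indicator_innerBoundary_ball le_rfl hv]
      simp [laplacian, h0]
    obtain ⟨u, c, hpos, hzero, hlap⟩ := exists_plusLevelFun hn
    set f : ℤ → ℤ → ℝ := fun x y => if 0 ≤ x + y then u x y else u (-x) (-y) with hf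
    have hf1 : ∀ x y, 0 ≤ x → 0 ≤ y → f x y = u x y := fun x y hx hy => if_pos (by omega)
    have hf2 : ∀ x y, 0 ≤ x → 0 ≤ y → f (-x) (-y) = u x y := fun x y hx hy => by
      simp only [hf, neg_neg]
      split_ifs
      · obtain rfl : x = 0 := by omega
        obtain rfl : y = 0 := by omega
        simp
      · rfl
    refine ⟨fun v => f v.1.1 v.1.2, fun v hv => ?_, fun v hv => ?_, fun v hv => ?_⟩
    · rw [Int.abs_eq_natAbs] at hv
      have hv' := hv
      unfold level at hv'
      simp only [hf]
      split_ifs with h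
      · refine hpos _ _ ?_ (by omega)
        rcases mem_verts_iff.1 v.2 with h1 | h1
        · exact h1
        · have h2 : 0 ≤ -v.1.1 ∧ 0 ≤ -v.1.2 := nonneg_of_mem_plusVerts h1
          have h3 : v.1.1 = 0 := by omega
          have h4 : v.1.2 = 0 := by omega
          change (v.1.1, v.1.2) ∈ plusVerts
          rw [h3, h4] at h1 ⊢
          simpa using h1
      · exact hpos _ _ (mem_plusVerts_of_level_neg (by unfold level; omega)) (by omega)
    · unfold level at hv
      rw [Int.abs_eq_natAbs] at hv
      simp only [hf]
      split_ifs with h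
      · exact hzero _ _ (by omega)
      · exact hzero _ _ (by omega)
    · have h0 : level v ≠ 0 := fun h => hv (eq_origin_of_level_eq_zero h)
      rw [laplacian, sum_neighborFinset, indicator_ball,
        indicator_innerBoundary_ball (by omega) hv]
      have h0' := h0
      unfold level at h0'
      rcases h0.lt_or_gt with h | h
      · have h' := h
        unfold level at h'
        have hp := mem_plusVerts_of_level_neg h
        have e1 : cellLap cellInd (fun a b => f (-a) (-b)) (-v.1.1) (-v.1.2) =
            cellLap cellInd u (-v.1.1) (-v.1.2) := by
          refine cellLap_congr (fun a b hab => ?_) _ _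
          have hab' : IsCell a b := by
            by_contra hc
            exact hab (if_neg hc)
          have := hab'.nonneg
          exact ⟨hf2 _ _ (by omega) (by omega), hf2 _ _ (by omega) (by omega),
            hf2 _ _ (by omega) (by omega)⟩
        rw [hlap, cellLap_eq, cellCount_eq_two hp (by omega),
          cellCount_belowLevel hp (by omega)] at e1
        have d : dirac 0 0 (-v.1.1) (-v.1.2) = 0 := if_neg (by omega)
        simp only [neg_neg] at e1
        have e2 : |level v| = -v.1.1 + -v.1.2 := by
          rw [abs_of_neg h, level]
          ring
        rw [cellSum_eq_zero_of_neg _ h', e2, cellInd_eq_zero (a := v.1.1) (by omega), zero_add,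
          zero_add]
        rw [d] at e1
        linarith
      · have h' := h
        unfold level at h'
        have hp := mem_plusVerts_of_level_pos h
        have e1 : cellLap cellInd f v.1.1 v.1.2 = cellLap cellInd u v.1.1 v.1.2 := by
          refine cellLap_congr (fun a b hab => ?_) _ _
          have hab' : IsCell a b := by
            by_contra hc
            exact hab (if_neg hc)
          have := hab'.nonneg
          exact ⟨hf1 _ _ (by omega) (by omega), hf1 _ _ (by omega) (by omega),
            hf1 _ _ (by omega) (by omega)⟩
        rw [hlap, cellLap_eq, cellCount_eq_two hp (by omega),
          cellCount_belowLevel hp (by omega)] at e1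
        have d : dirac 0 0 v.1.1 v.1.2 = 0 := if_neg (by omega)
        have e2 : |level v| = v.1.1 + v.1.2 := by rw [abs_of_pos h, level]
        rw [cellSum_eq_zero_of_neg _ (by omega : -v.1.1 + -v.1.2 < 0), e2,
          cellInd_eq_zero (a := -v.1.1) (by omega), add_zero, add_zero]
        rw [d] at e1
        linarith
  -- The constant is whatever makes the equation hold at the origin; its value is found in
  -- `exists_ballFun` by summing over a large ball.
  refine ⟨U, (ball n).indicator 1 origin -
    1 / 2 * (innerBoundary (ball n)).indicator 1 origin - laplacian U origin, hpos, hzero,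
    fun v => ?_⟩
  by_cases hv : v = origin
  · subst hv
    rw [Pi.single_eq_same]
    ring
  · rw [hlap v hv, Pi.single_eq_of_ne hv]
    ring

/-- Conservation of mass: exchanging the order of summation, each point of the support is counted by
its four neighbours, all of which lie in `S`. -/
theorem sum_laplacian_eq_zero {S : Finset verts} {U : verts → ℝ}
    (h : ∀ v, U v ≠ 0 → v ∈ S ∧ ∀ q, SG.Adj v q → q ∈ S) : ∑ v ∈ S, laplacian U v = 0 := by
  classical
  have h1 : ∀ v, ∑ q ∈ SG.neighborFinset v, U q = ∑ q ∈ S, if SG.Adj v q then U q else 0 := by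
    intro v
    rw [← Finset.sum_filter]
    refine Finset.sum_subset_zero_on_sdiff (s₁ := S.filter _) (s₂ := SG.neighborFinset v) ?_ ?_ ?_ |>.symm
    · intro q hq
      simpa using (Finset.mem_filter.1 hq).2
    · intro q hq
      by_contra hU
      simp only [Finset.mem_sdiff, SimpleGraph.mem_neighborFinset, Finset.mem_filter] at hq
      exact hq.2 ⟨(h q hU).1, hq.1⟩
    · exact fun _ _ => rfl
  have h2 : ∀ q ∈ S, (∑ v ∈ S, if SG.Adj v q then U q else 0) = 4 * U q := by
    intro q _
    by_cases hU : U q = 0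
    · simp [hU]
    · have h3 : S.filter (fun v => SG.Adj v q) = SG.neighborFinset q := by
        ext v
        simp only [Finset.mem_filter, SimpleGraph.mem_neighborFinset, SG.adj_comm v q]
        exact ⟨And.right, fun hv => ⟨(h q hU).2 v hv, hv⟩⟩
      rw [← Finset.sum_filter, h3, Finset.sum_const, nsmul_eq_mul, card_neighborFinset]
  simp only [laplacian, h1]
  rw [Finset.sum_sub_distrib, ← Finset.mul_sum, Finset.sum_comm, Finset.sum_congr rfl h2,
    ← Finset.mul_sum]
  ring

/-- For every `n` there is a function, positive exactly on the ball of radius `n - 1`, whose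
Laplacian transports mass `ballMass n` at the origin to mass `1` on the ball of radius `n`, halved
on the inner boundary. -/
theorem exists_ballFun (n : ℕ) : ∃ U : verts → ℝ,
    (∀ v, |level v| < n → 0 < U v) ∧ (∀ v, (n : ℤ) ≤ |level v| → U v = 0) ∧
    ∀ v, laplacian U v = (ball n).indicator 1 v -
      1 / 2 * (innerBoundary (ball n)).indicator 1 v - ballMass n * (Pi.single origin 1 : verts → ℝ) v := by
  classical
  obtain ⟨U, c, hpos, hzero, hlap⟩ := exists_ballFun_aux n
  suffices hc : c = ballMass n from ⟨U, hpos, hzero, hc ▸ hlap⟩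
  set S := (finite_ball (n + 1)).toFinset with hS
  have hmem : ∀ v, v ∈ S ↔ |level v| ≤ n + 1 := fun v => by
    rw [hS, Set.Finite.mem_toFinset, mem_ball_iff]
  have h0 : ∑ v ∈ S, laplacian U v = 0 := by
    refine sum_laplacian_eq_zero fun v hv => ?_
    have hlt : |level v| < n := by
      by_contra h
      exact hv (hzero v (by omega))
    exact ⟨(hmem v).2 (by omega), fun q hq =>
      (hmem q).2 (by have := abs_level_le_of_adj hq; omega)⟩
  have hsub : ball n ⊆ S := fun v hv => by
    have := mem_ball_iff.1 hv
    exact (hmem v).2 (by omega)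
  have hcard : ∀ A : Set verts, A ⊆ ball n →
      ∑ v ∈ S, A.indicator (1 : verts → ℝ) v = A.ncard := fun A hA => by
    have hfin : A.Finite := (finite_ball n).subset hA
    have := Finset.sum_indicator_subset (1 : verts → ℝ) (s := hfin.toFinset) (t := S)
      (fun v hv => hsub (hA (hfin.mem_toFinset.1 hv)))
    rw [hfin.coe_toFinset] at this
    rw [this, Set.ncard_eq_toFinset_card A hfin]
    simp
  have horigin : origin ∈ S := (hmem _).2 (by rw [level_origin, abs_zero]; omega)
  have hsingle : ∑ v ∈ S, (Pi.single origin (1 : ℝ) : verts → ℝ) v = 1 := by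
    rw [Finset.sum_pi_single', if_pos horigin]
  simp only [hlap] at h0
  rw [Finset.sum_sub_distrib, Finset.sum_sub_distrib, ← Finset.mul_sum, ← Finset.mul_sum,
    hcard _ subset_rfl, hcard _ fun v hv => hv.1, hsingle] at h0
  unfold ballMass
  linarith

/-! ### Growth of the balls -/

theorem axis_mem_iterVerts (k : ℕ) {j : ℤ} (h0 : 0 ≤ j) (h : j ≤ 2 ^ k) : (j, 0) ∈ iterVerts k := by
  induction k generalizing j with
  | zero =>
    rw [pow_zero] at h
    rw [mem_iterVerts_zero]
    omega
  | succ k ih =>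
    rw [pow_succ] at h
    rw [mem_iterVerts_succ]
    rcases le_or_gt j (2 ^ k) with h1 | h1
    · exact Or.inl (ih h0 h1)
    · exact Or.inr (Or.inl (ih (by omega) (by omega)))

/-- The vertex `(j, 0)`. -/
def axisVertex (j : ℕ) : verts :=
  ⟨(j, 0), Or.inl (Set.mem_iUnion.2 ⟨j, axis_mem_iterVerts j (by omega)
    (by exact_mod_cast Nat.lt_two_pow_self.le)⟩)⟩

theorem level_axisVertex (j : ℕ) : level (axisVertex j) = j := add_zero _

/-- A crude bound from the vertices on an axis suffices: it makes `ballMass` unbounded, so that a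
stabilizing function exists for every `m` and the maximal `n` exists. -/
theorem ballMass_ge (n : ℕ) : ((n : ℝ) + 1) / 2 ≤ ballMass n := by
  have h1 : n + 1 ≤ (ball n).ncard := by
    have hinj : Function.Injective axisVertex := fun i j hij => by
      have := congrArg level hij
      simpa [level_axisVertex] using this
    calc n + 1 = ((Finset.range (n + 1)).map ⟨axisVertex, hinj⟩).card := by simp
      _ = (((Finset.range (n + 1)).map ⟨axisVertex, hinj⟩ : Finset verts) : Set verts).ncard :=
        (Set.ncard_coe_finset _).symm
      _ ≤ (ball n).ncard := by
        refine Set.ncard_le_ncard (fun v hv => ?_) (finite_ball n)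
        simp only [Finset.coe_map, Set.mem_image, Finset.mem_coe, Finset.mem_range,
          Function.Embedding.coeFn_mk] at hv
        obtain ⟨j, hj, rfl⟩ := hv
        rw [mem_ball_iff, level_axisVertex, Nat.abs_cast]
        omega
  have h2 : (innerBoundary (ball n)).ncard ≤ (ball n).ncard :=
    Set.ncard_le_ncard (fun v hv => hv.1) (finite_ball n)
  have h1' : (n : ℝ) + 1 ≤ (ball n).ncard := by exact_mod_cast h1
  have h2' : ((innerBoundary (ball n)).ncard : ℝ) ≤ (ball n).ncard := by exact_mod_cast h2
  unfold ballMass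
  linarith

theorem ballMass_zero : ballMass 0 = 1 / 2 := by
  have h1 : ball (0 : ℕ) = {origin} := by
    ext v
    rw [mem_ball_iff, Nat.cast_zero, abs_nonpos_iff, Set.mem_singleton_iff]
    exact ⟨eq_origin_of_level_eq_zero, fun h => h ▸ level_origin⟩
  have h2 : innerBoundary (ball (0 : ℕ)) = {origin} := by
    ext v
    rw [mem_innerBoundary_ball_iff (by simp), Nat.cast_zero, abs_eq_zero, Set.mem_singleton_iff]
    refine ⟨fun h => eq_origin_of_level_eq_zero h.1, ?_⟩
    rintro rfl
    exact ⟨level_origin, Or.inl isCell_zero⟩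
  rw [ballMass, h2, h1, Set.ncard_singleton]
  norm_num

/-! ### The least action principle and convergence of the odometer -/

/-- `w` is nonnegative, and transporting the mass `w` lowers the sand `μ₀` to at most `h`. -/
def IsStabilizing (h μ₀ w : verts → ℝ) : Prop :=
  (∀ v, 0 ≤ w v) ∧ ∀ v, laplacian w v + μ₀ v ≤ h v

theorem laplacian_single_self (x : verts) : laplacian (Pi.single x 1) x = -1 := by
  have h : ∑ y ∈ SG.neighborFinset x, (Pi.single x (1 : ℝ) : verts → ℝ) y = 0 :=
    Finset.sum_eq_zero fun y hy => Pi.single_eq_of_ne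
      (SG.ne_of_adj ((SG.mem_neighborFinset x y).1 hy)).symm _
  rw [laplacian, h, Pi.single_eq_same]
  norm_num

theorem laplacian_add_mul (f g : verts → ℝ) (a : ℝ) (v : verts) :
    laplacian (fun y => f y + a * g y) v = laplacian f v + a * laplacian g v := by
  simp only [laplacian, Finset.sum_add_distrib, ← Finset.mul_sum]
  ring

theorem partialOdometer_succ_eq (h μ₀ : verts → ℝ) (x : ℕ → verts) (k : ℕ) :
    partialOdometer h μ₀ x (k + 1) = fun y => partialOdometer h μ₀ x k y +
      max (sand h μ₀ x k (x k) - h (x k)) 0 * (Pi.single (x k) 1 : verts → ℝ) y := by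
  ext y
  simp only [partialOdometer, Finset.sum_filter, Finset.sum_range_succ]
  congr 1
  split_ifs with hy
  · subst hy
    simp only [sand, topple, laplacian_single_self, Pi.single_eq_same]
    ring
  · rw [Pi.single_eq_of_ne (Ne.symm hy), mul_zero]

theorem sand_eq (h μ₀ : verts → ℝ) (x : ℕ → verts) (k : ℕ) (y : verts) :
    sand h μ₀ x k y = μ₀ y + laplacian (partialOdometer h μ₀ x k) y := by
  induction k generalizing y with
  | zero => simp [sand, partialOdometer, laplacian]
  | succ k ih =>
    rw [partialOdometer_succ_eq, laplacian_add_mul, sand, topple, ih y]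
    ring

/-- Toppling becomes a maximum with an expression increasing in the neighbouring values.
Monotonicity in time and comparison with stabilizing functions both follow from this form. -/
theorem partialOdometer_succ (h μ₀ : verts → ℝ) (x : ℕ → verts) (k : ℕ) (y : verts) :
    (x k = y → partialOdometer h μ₀ x (k + 1) y = max (partialOdometer h μ₀ x k y)
      (μ₀ y + 1 / 4 * ∑ q ∈ SG.neighborFinset y, partialOdometer h μ₀ x k q - h y)) ∧
    (x k ≠ y → partialOdometer h μ₀ x (k + 1) y = partialOdometer h μ₀ x k y) := by
  constructor
  · rintro rfl
    rw [partialOdometer_succ_eq]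
    simp only [Pi.single_eq_same, mul_one]
    rw [sand_eq, laplacian, max_comm (_ - _), ← max_add_add_left]
    congr 1 <;> ring
  · intro hy
    rw [partialOdometer_succ_eq]
    simp only [Pi.single_eq_of_ne (Ne.symm hy), mul_zero, add_zero]

theorem monotone_partialOdometer (h μ₀ : verts → ℝ) (x : ℕ → verts) (y : verts) :
    Monotone fun k => partialOdometer h μ₀ x k y := by
  refine monotone_nat_of_le_succ fun k => ?_
  by_cases hy : x k = y
  · rw [(partialOdometer_succ h μ₀ x k y).1 hy]
    exact le_max_left _ _
  · exact ((partialOdometer_succ h μ₀ x k y).2 hy).ge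

theorem partialOdometer_le {h μ₀ w : verts → ℝ} (hw : IsStabilizing h μ₀ w) (x : ℕ → verts)
    (k : ℕ) (y : verts) : partialOdometer h μ₀ x k y ≤ w y := by
  induction k generalizing y with
  | zero => simpa [partialOdometer] using hw.1 y
  | succ k ih =>
    by_cases hy : x k = y
    · rw [(partialOdometer_succ h μ₀ x k y).1 hy]
      refine max_le (ih y) ?_
      have h1 := hw.2 y
      have h2 : ∑ q ∈ SG.neighborFinset y, partialOdometer h μ₀ x k q ≤
          ∑ q ∈ SG.neighborFinset y, w q := Finset.sum_le_sum fun q _ => ih q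
      rw [laplacian] at h1
      linarith
    · rw [(partialOdometer_succ h μ₀ x k y).2 hy]
      exact ih y

theorem exists_limit_partialOdometer {h μ₀ w : verts → ℝ} (hw : IsStabilizing h μ₀ w)
    {x : ℕ → verts} (hx : IsTopplingSeq x) : ∃ u, IsStabilizing h μ₀ u ∧
      ∀ y, Tendsto (fun k => partialOdometer h μ₀ x k y) atTop (𝓝 (u y)) := by
  have hlim : ∀ y, Tendsto (fun k => partialOdometer h μ₀ x k y) atTop
      (𝓝 (⨆ k, partialOdometer h μ₀ x k y)) := fun y => by
    refine tendsto_atTop_ciSup (monotone_partialOdometer h μ₀ x y) ⟨w y, ?_⟩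
    rintro _ ⟨k, rfl⟩
    exact partialOdometer_le hw x k y
  refine ⟨fun y => ⨆ k, partialOdometer h μ₀ x k y, ⟨fun y => ?_, fun y => ?_⟩, hlim⟩
  · refine ge_of_tendsto' (hlim y) fun k => ?_
    calc (0 : ℝ) = partialOdometer h μ₀ x 0 y := by simp [partialOdometer]
      _ ≤ _ := monotone_partialOdometer h μ₀ x y (Nat.zero_le k)
  · have h1 : Tendsto (fun k => μ₀ y + 1 / 4 * ∑ q ∈ SG.neighborFinset y,
        partialOdometer h μ₀ x k q - h y) atTop (𝓝 (μ₀ y + 1 / 4 * ∑ q ∈ SG.neighborFinset y,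
        (⨆ k, partialOdometer h μ₀ x k q) - h y)) :=
      ((tendsto_finsetSum _ fun q _ => hlim q).const_mul _ |>.const_add _).sub_const _
    have h2 : Tendsto (fun k => partialOdometer h μ₀ x (k + 1) y) atTop
        (𝓝 (⨆ k, partialOdometer h μ₀ x k y)) := (hlim y).comp (tendsto_add_atTop_nat 1)
    -- Just after `y` topples, its mass is at most `h y`. This happens infinitely often, which is
    -- enough to pass to the limit.
    have h3 : ∃ᶠ k in atTop, μ₀ y + 1 / 4 * ∑ q ∈ SG.neighborFinset y,
        partialOdometer h μ₀ x k q - h y ≤ partialOdometer h μ₀ x (k + 1) y := by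
      refine (Nat.frequently_atTop_iff_infinite.2 (hx y)).mono fun k hk => ?_
      rw [(partialOdometer_succ h μ₀ x k y).1 hk]
      exact le_max_right _ _
    have h4 := le_of_tendsto_of_tendsto_of_frequently h1 h2 h3
    rw [laplacian]
    linarith

/-- If some function stabilizes the sand, then the odometer function exists, and it is the least
stabilizing function. -/
theorem exists_isOdometer {h μ₀ w : verts → ℝ} (hw : IsStabilizing h μ₀ w) :
    ∃ u, IsOdometer h μ₀ u ∧ IsStabilizing h μ₀ u ∧
      ∀ w', IsStabilizing h μ₀ w' → ∀ y, u y ≤ w' y := by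
  have hle : ∀ {x : ℕ → verts} {u w' : verts → ℝ},
      (∀ y, Tendsto (fun k => partialOdometer h μ₀ x k y) atTop (𝓝 (u y))) →
      IsStabilizing h μ₀ w' → ∀ y, u y ≤ w' y := fun {x} {u} {w'} hu hw' y =>
    le_of_tendsto' (hu y) fun k => partialOdometer_le hw' _ k y
  obtain ⟨x₀, hx₀⟩ := exists_isTopplingSeq
  obtain ⟨u, hu, hlim⟩ := exists_limit_partialOdometer hw hx₀
  refine ⟨u, fun x hx y => ?_, hu, fun w' hw' => hle hlim hw'⟩
  obtain ⟨u', hu', hlim'⟩ := exists_limit_partialOdometer hw hx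
  -- The limits along two toppling sequences are both stabilizing and each lies below every
  -- stabilizing function, so they coincide.
  rw [le_antisymm (hle hlim hu' y) (hle hlim' hu y)]
  exact hlim' y

/-! ### Comparison of the odometer with the ball functions -/

theorem isStabilizing_of_le_ballMass {n : ℕ} {m : ℝ} (hm : m ≤ ballMass n) {U : verts → ℝ}
    (hpos : ∀ v, |level v| < n → 0 < U v) (hzero : ∀ v, (n : ℤ) ≤ |level v| → U v = 0)
    (hlap : ∀ v, laplacian U v = (ball n).indicator 1 v -
      1 / 2 * (innerBoundary (ball n)).indicator 1 v - ballMass n * (Pi.single origin 1 : verts → ℝ) v) :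
    IsStabilizing (fun _ => 1) (Pi.single origin m) U := by
  constructor
  · intro v
    rcases lt_or_ge |level v| (n : ℤ) with h | h
    · exact (hpos v h).le
    · exact (hzero v h).ge
  · intro v
    have h1 : (ball n).indicator (1 : verts → ℝ) v ≤ 1 :=
      Set.indicator_le_self' (fun _ _ => zero_le_one) v
    have h2 : 0 ≤ (innerBoundary (ball n)).indicator (1 : verts → ℝ) v :=
      Set.indicator_nonneg (fun _ _ => zero_le_one) v
    rw [hlap]
    by_cases hv : v = origin
    · subst hv
      rw [Pi.single_eq_same, Pi.single_eq_same]
      linarith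
    · rw [Pi.single_eq_of_ne hv, Pi.single_eq_of_ne hv]
      linarith

/-- Minimum principle for `u - U`: at distance less than `n` it is superharmonic, since `ΔU = 1 -
ballMass n · δ_o` there while `Δu ≤ 1 - mδ_o`, and from distance `n` on it equals `u ≥ 0`. A
negative minimum would spread by connectedness to `axisVertex n`, where `U` vanishes. -/
theorem le_of_isStabilizing {n : ℕ} {m : ℝ} (hm : ballMass n ≤ m) {U u : verts → ℝ}
    (hzero : ∀ v, (n : ℤ) ≤ |level v| → U v = 0)
    (hlap : ∀ v, laplacian U v = (ball n).indicator 1 v -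
      1 / 2 * (innerBoundary (ball n)).indicator 1 v - ballMass n * (Pi.single origin 1 : verts → ℝ) v)
    (hu : IsStabilizing (fun _ => 1) (Pi.single origin m) u) (v : verts) : U v ≤ u v := by
  by_contra! hv
  have hlt : ∀ y, u y - U y < 0 → |level y| < n := fun y hy => by
    by_contra h
    have := hzero y (by omega)
    have := hu.1 y
    linarith
  obtain ⟨x, -, hx⟩ := Finset.exists_min_image (finite_ball n).toFinset (fun y => u y - U y)
    ⟨v, (finite_ball n).mem_toFinset.2 (mem_ball_iff.2 (hlt v (by linarith)).le)⟩
  have hneg : u x - U x < 0 := by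
    have := hx v ((finite_ball n).mem_toFinset.2 (mem_ball_iff.2 (hlt v (by linarith)).le))
    linarith
  have hmin : ∀ y, u x - U x ≤ u y - U y := fun y => by
    by_contra! hy
    have := hx y ((finite_ball n).mem_toFinset.2 (mem_ball_iff.2 (hlt y (by linarith)).le))
    linarith
  have hstep : ∀ y q, SG.Adj y q → u y - U y = u x - U x → u q - U q = u x - U x := by
    intro y q hyq hy
    have hly := hlt y (by linarith)
    have h1 : (ball n).indicator (1 : verts → ℝ) y = 1 := by
      rw [indicator_ball, if_pos hly.le]
    have h2 : (innerBoundary (ball n)).indicator (1 : verts → ℝ) y = 0 :=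
      Set.indicator_of_notMem (fun h => hly.ne
        ((mem_innerBoundary_ball_iff (by omega)).1 h).1) _
    have h3 := hlap y
    rw [h1, h2] at h3
    have h4 := hu.2 y
    have h5 : ballMass n * (Pi.single origin (1 : ℝ) : verts → ℝ) y ≤
        (Pi.single origin m : verts → ℝ) y := by
      by_cases ho : y = origin
      · subst ho
        rw [Pi.single_eq_same, Pi.single_eq_same, mul_one]
        exact hm
      · rw [Pi.single_eq_of_ne ho, Pi.single_eq_of_ne ho, mul_zero]
    have h6 : ∑ q ∈ SG.neighborFinset y, ((u q - U q) - (u x - U x)) ≤ 0 := by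
      rw [Finset.sum_sub_distrib, Finset.sum_sub_distrib, Finset.sum_const, nsmul_eq_mul,
        card_neighborFinset]
      rw [laplacian] at h3 h4
      linarith
    have h7 : ∀ q ∈ SG.neighborFinset y, 0 ≤ (u q - U q) - (u x - U x) := fun q _ =>
      sub_nonneg.2 (hmin q)
    have h8 := (Finset.sum_eq_zero_iff_of_nonneg h7).1 (le_antisymm h6 (Finset.sum_nonneg h7)) q
      ((SG.mem_neighborFinset y q).2 hyq)
    linarith
  have hall : ∀ y z, SG.Walk y z → u y - U y = u x - U x → u z - U z = u x - U x := by
    intro y z p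
    induction p with
    | nil => exact id
    | cons hadj _ ih => exact fun hy => ih (hstep _ _ hadj hy)
  obtain ⟨p⟩ := SG_preconnected x (axisVertex n)
  have h1 := hall _ _ p rfl
  have h2 := hlt (axisVertex n) (by linarith)
  rw [level_axisVertex, Nat.abs_cast] at h2
  exact lt_irrefl _ h2

end Gasket

/-! ### Proof of the theorem -/

theorem theorem1 (m : ℝ) (hm : 0 ≤ m) :
    ∃ u : Gasket.verts → ℝ,
      Gasket.IsOdometer (fun _ => 1) (Pi.single Gasket.origin m) u ∧
      (m < 1 / 2 → Gasket.cluster u = ∅) ∧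
      (1 / 2 ≤ m → ∃ n : ℕ, IsGreatest {k : ℕ | Gasket.ballMass k ≤ m} n ∧
        Gasket.ball ((n : ℤ) - 1) ⊆ Gasket.cluster u ∧
        Gasket.cluster u ⊆ Gasket.ball n) := by
  obtain ⟨N, hN⟩ := exists_nat_ge (2 * m)
  have hlarge : ∀ k : ℕ, N ≤ k → m < Gasket.ballMass k := fun k hk => by
    have h1 := Gasket.ballMass_ge k
    have h2 : (N : ℝ) ≤ k := by exact_mod_cast hk
    linarith
  obtain ⟨W, hW1, hW2, hW3⟩ := Gasket.exists_ballFun N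
  obtain ⟨u, hu, hstab, hleast⟩ := Gasket.exists_isOdometer
    (Gasket.isStabilizing_of_le_ballMass (hlarge N le_rfl).le hW1 hW2 hW3)
  have hupper : ∀ k : ℕ, m ≤ Gasket.ballMass k → ∀ v, 0 < u v → |Gasket.level v| < k := by
    intro k hk v hv
    obtain ⟨U, h1, h2, h3⟩ := Gasket.exists_ballFun k
    by_contra h
    have := hleast U (Gasket.isStabilizing_of_le_ballMass hk h1 h2 h3) v
    rw [h2 v (by omega)] at this
    linarith
  refine ⟨u, hu, fun hlt => ?_, fun hge => ?_⟩
  · refine Set.eq_empty_of_forall_notMem fun v hv => ?_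
    -- As `ballMass 0 = 1 / 2`, radius `0` is admissible, and no vertex has negative distance.
    have := hupper 0 (by rw [Gasket.ballMass_zero]; exact hlt.le) v hv
    exact absurd this (by simp)
  · have hne : {k : ℕ | Gasket.ballMass k ≤ m}.Nonempty :=
      ⟨0, Gasket.ballMass_zero.le.trans hge⟩
    have hbdd : BddAbove {k : ℕ | Gasket.ballMass k ≤ m} := ⟨N, fun k hk => by
      by_contra! h
      exact (hlarge k h.le).not_ge hk⟩
    have hmem := Nat.sSup_mem hne hbdd
    set n := sSup {k : ℕ | Gasket.ballMass k ≤ m}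
    refine ⟨n, ⟨hmem, fun k hk => le_csSup hbdd hk⟩, fun v hv => ?_, fun v hv => ?_⟩
    · obtain ⟨U, h1, h2, h3⟩ := Gasket.exists_ballFun n
      have h4 := Gasket.mem_ball_iff.1 hv
      exact (h1 v (by omega)).trans_le (Gasket.le_of_isStabilizing hmem h2 h3 hstab v)
    -- Only `n + 1` failing the defining inequality is used; `|level v| < n + 1` then means
    -- membership in the ball of radius `n`.
    · have h1 : m < Gasket.ballMass (n + 1) := by
        by_contra! h
        exact absurd (le_csSup hbdd h) (by simp [n])
      have h2 := hupper (n + 1) h1.le v hv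
      push_cast at h2
      exact Gasket.mem_ball_iff.2 (by omega)
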